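/- Let $C=[-\tfrac12,\tfrac12]^3\subset\mathbb{R}^3$ be the cube of unit edge length, let $U=(x_1,x_2,x_3)$ be uniformly distributed on the unit sphere of $\mathbb{R}^3$, and let $S=U^\perp$ be the plane through the origin orthogonal to $U$ (a uniformly random plane). Let $cw$ (chorowidth) be the area and $pw$ (periwidth) the circumference of the orthogonal projection (shadow) of $C$ on $S$. Let $$ {}_3F_2(a_1,a_2,a_3;b_1,b_2;z)=\frac{\Gamma(b_1)\Gamma(b_2)}{\Gamma(a_1)\Gamma(a_2)\Gamma(a_3)}\sum_{k=0}^{\infty}\frac{\Gamma(a_1+k)\Gamma(a_2+k)\Gamma(a_3+k)}{\Gamma(b_1+k)\Gamma(b_2+k)}\,\frac{z^k}{k!} $$ be the generalized hypergeometric function; the series converges for the parameters used below. Then for every unit vector $U$ $$ cw=|x_1|+|x_2|+|x_3|,\qquad pw=2\sum_{i=1}^{3}\sqrt{1-x_i^2}, $$ both $cw$ and $pw$ have finite second moments, and $$ \mathbb{E}(cw)=\tfrac32,\qquad \mathbb{E}(cw^2)=1+\tfrac{4}{\pi}=2.273239544735162\ldots,\qquad \mathbb{E}(pw)=\tfrac{3\pi}{2}=4.712388980384689\ldots,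 $$ $$ \mathbb{E}(pw^2)=8+6\pi\;{}_3F_2\!\left(-\tfrac12,\tfrac12,\tfrac32;1,2;1\right)=22.237117433439470\ldots,\qquad \mathbb{E}(cw\cdot pw)=2+\tfrac{16}{\pi}=7.092958178940650\ldots . $$ Moreover, with the complete elliptic integral of the second kind $E(\xi)=\int_0^{\pi/2}\sqrt{1-\xi^2\sin^2\theta}\,d\theta$, $$ \int_0^{\pi/2}E(\sin\varphi)\sin^2\varphi\,d\varphi=\frac{\pi^2}{8}\;{}_3F_2\!\left(-\tfrac12,\tfrac12,\tfrac32;1,2;1\right). $$ Consequently the correlation coefficient of the area $cw$ and the perimeter $pw$ of the shadow is $0.915\ldots$, i.e. it lies in $[0.915,0.916)$. (All decimals are truncated.) -/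

import Mathlib

open MeasureTheory ProbabilityTheory Set

noncomputable section

namespace CubeShadow

/-- Euclidean three-space. -/
abbrev E3 : Type := EuclideanSpace ℝ (Fin 3)

/-- The unit sphere of three-space; its points are the unit normals of the projection planes. -/
abbrev S2 : Type := Metric.sphere (0 : E3) 1

/-- The uniform distribution on the unit sphere: normalized surface measure. -/
def uniformS2 : Measure S2 :=
  ((volume : Measure E3).toSphere univ)⁻¹ • (volume : Measure E3).toSphere

instance : IsProbabilityMeasure uniformS2 := by
  refine ⟨?_⟩
  rw [uniformS2, Measure.smul_apply, smul_eq_mul]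
  refine ENNReal.inv_mul_cancel ?_ (measure_ne_top _ _)
  rw [Ne, Measure.measure_univ_eq_zero]
  exact (volume : Measure E3).toSphere_ne_zero

/-- The plane through the origin of all vectors orthogonal to `U`. -/
abbrev plane (U : S2) : Submodule ℝ E3 := (Submodule.span ℝ {(U : E3)})ᗮ

/-- The cube of unit edge length centered at the origin, with vertices `(±1/2, ±1/2, ±1/2)`. -/
def unitCube : Set E3 := {v | ∀ i, |v i| ≤ 1 / 2}

/-- The shadow of the cube: its orthogonal projection on the plane orthogonal to `U`,
as a subset of that plane. -/
def shadow (U : S2) : Set (plane U) := (plane U).orthogonalProjectionOnto '' unitCube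

/-- Chorowidth: the area (two-dimensional Lebesgue measure of the Euclidean plane `plane U`)
of the shadow. -/
def cw (U : S2) : ℝ := (volume : Measure (plane U)).real (shadow U)

/-- Periwidth: the circumference of the shadow, that is, the length (one-dimensional Hausdorff
measure) of its boundary relative to the plane. -/
def pw (U : S2) : ℝ := (μH[1] : Measure (plane U)).real (frontier (shadow U))

/-- The `k`-th term of the series defining `₃F₂(a₁, a₂, a₃; b₁, b₂; z)`,
without the normalizing factor. -/
def hyp3F2Term (a₁ a₂ a₃ b₁ b₂ z : ℝ) (k : ℕ) : ℝ :=
  Real.Gamma (a₁ + k) * Real.Gamma (a₂ + k) * Real.Gamma (a₃ + k) /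
    (Real.Gamma (b₁ + k) * Real.Gamma (b₂ + k)) * (z ^ k / (k.factorial : ℝ))

/-- The generalized hypergeometric function `₃F₂(a₁, a₂, a₃; b₁, b₂; z)`. -/
def hyp3F2 (a₁ a₂ a₃ b₁ b₂ z : ℝ) : ℝ :=
  Real.Gamma b₁ * Real.Gamma b₂ / (Real.Gamma a₁ * Real.Gamma a₂ * Real.Gamma a₃) *
    ∑' k : ℕ, hyp3F2Term a₁ a₂ a₃ b₁ b₂ z k

/-- The complete elliptic integral of the second kind, as a function of the modulus. -/
def ellipticE (ξ : ℝ) : ℝ :=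
  ∫ θ in (0 : ℝ)..(Real.pi / 2), Real.sqrt (1 - ξ ^ 2 * Real.sin θ ^ 2)

/-- The (Pearson) correlation coefficient of two real random variables. -/
def correlation {Ω : Type*} [MeasurableSpace Ω] (X Y : Ω → ℝ) (μ : Measure Ω) : ℝ :=
  cov[X, Y; μ] / (Real.sqrt (Var[X; μ]) * Real.sqrt (Var[Y; μ]))

end CubeShadow

end

noncomputable section

namespace CubeShadow

/-! Area. A point of the plane lies in the shadow exactly when the line through it in the direction
`U` meets the cube, so the slab of height 1 over the shadow has the shadow's area as volume
(`volume_shadow`). Sliding the slab's points along `U` into a coordinate plane turns the shadow into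
the region swept by a unit square moving along a segment. Fubini gives its area
(`volume_sweptSquare`), and the change of scale yields `cw_eq`.

Perimeter. Intersecting three intervals on a line shows that the cylinder over the cube is cut out
by strips, one for each pair of coordinates (`mem_cubeCylinder_iff`). The rim of the shadow is where
one of these inequalities is an equality (`frontier_shadow`). If no coordinate of `U` vanishes, the
rim is a hexagon whose sides are projections of cube edges, two for each axis, of length `√(1 -
xᵢ²)`. If some coordinate vanishes, it is a rectangle. The same formula results in both cases
(`pw_eq`).

Moments. Expanding squares and products leaves means of functions of one or two coordinates. By
symmetry these are integrals over one octant in spherical coordinates with the first axis as polar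
axis (`integral_coord_pair_octant`). All but one split into elementary one-variable integrals. The
exception, the mean of `√(1 - xᵢ²) √(1 - xⱼ²)`, becomes the elliptic integral. Expanding its square
root in a binomial series and integrating termwise with Wallis' formula gives the hypergeometric
series (`ellipticE_integral`).

Decimals. The series converges only like `∑ k^(-5/2)`, so its tail is enclosed by telescoping with a
truncated asymptotic expansion of (tail)/(term). One hundred exact terms then give 17 digits, enough
for all the moments and for the correlation in spite of the cancellation in the variances. -/

/-! ### Spherical coordinates and the uniform measure on the sphere -/

/-- The point of `E3` with the given coordinates. -/
def vec (p : ℝ × ℝ × ℝ) : E3 := !₂[p.1, p.2.1, p.2.2]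

@[simp] lemma vec_zero (p : ℝ × ℝ × ℝ) : vec p 0 = p.1 := rfl
@[simp] lemma vec_one (p : ℝ × ℝ × ℝ) : vec p 1 = p.2.1 := rfl
@[simp] lemma vec_two (p : ℝ × ℝ × ℝ) : vec p 2 = p.2.2 := rfl

lemma measurePreserving_vec : MeasurePreserving vec := by
  have h1 := (volume_preserving_piFinSuccAbove (fun _ : Fin 3 => ℝ) 0).symm
  have h2 : MeasurePreserving (Prod.map id (MeasurableEquiv.finTwoArrow (α := ℝ)).symm)
      (volume : Measure (ℝ × ℝ × ℝ)) (volume : Measure (ℝ × (Fin 2 → ℝ))) :=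
    (MeasurePreserving.id (volume : Measure ℝ)).prod (volume_preserving_finTwoArrow ℝ).symm
  have h3 := PiLp.volume_preserving_toLp (Fin 3)
  convert! h3.comp (h1.comp h2) using 1
  funext p
  ext i
  fin_cases i <;> rfl

lemma measurable_vec : Measurable vec := measurePreserving_vec.measurable

lemma continuous_vec : Continuous vec := by
  unfold vec
  apply (PiLp.continuous_toLp 2 _).comp
  refine continuous_pi fun i => ?_
  fin_cases i <;> simp <;> fun_prop

/-- Integration over three-space in spherical coordinates. -/
lemma lintegral_spherical (h : ℝ × ℝ × ℝ → ENNReal) (hh : Measurable h) :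
    ∫⁻ p, h p = ∫⁻ θ in Ioo (-Real.pi) Real.pi, ∫⁻ φ in Ioo 0 Real.pi, ∫⁻ r in Ioi (0 : ℝ),
      ENNReal.ofReal (r ^ 2 * Real.sin φ) *
        h (r * Real.cos φ, r * Real.sin φ * Real.cos θ, r * Real.sin φ * Real.sin θ) := by
  have hpi := Real.pi_pos
  calc ∫⁻ p, h p = ∫⁻ z, ∫⁻ q : ℝ × ℝ, h (z, q) := by
        rw [Measure.volume_eq_prod, lintegral_prod _ hh.aemeasurable]
    _ = ∫⁻ z : ℝ, ∫⁻ q in Ioi (0 : ℝ) ×ˢ Ioo (-Real.pi) Real.pi,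
          ENNReal.ofReal q.1 * h (z, q.1 * Real.cos q.2, q.1 * Real.sin q.2) := by
        refine lintegral_congr fun z => ?_
        rw [← lintegral_comp_polarCoord_symm]
        rfl
    _ = ∫⁻ z : ℝ, ∫⁻ θ in Ioo (-Real.pi) Real.pi, ∫⁻ ρ in Ioi (0 : ℝ),
          ENNReal.ofReal ρ * h (z, ρ * Real.cos θ, ρ * Real.sin θ) := by
        refine lintegral_congr fun z => ?_
        rw [Measure.volume_eq_prod, ← Measure.prod_restrict, lintegral_prod_symm]
        fun_prop
    _ = ∫⁻ θ in Ioo (-Real.pi) Real.pi, ∫⁻ z : ℝ, ∫⁻ ρ in Ioi (0 : ℝ),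
          ENNReal.ofReal ρ * h (z, ρ * Real.cos θ, ρ * Real.sin θ) := by
        rw [lintegral_lintegral_swap]
        apply Measurable.aemeasurable
        refine Measurable.lintegral_prod_right'
          (f := fun (x : (ℝ × ℝ) × ℝ) =>
            ENNReal.ofReal x.2 * h (x.1.1, x.2 * Real.cos x.1.2, x.2 * Real.sin x.1.2)) ?_
        fun_prop
    _ = _ := by
        refine lintegral_congr fun θ => ?_
        -- A second passage to polar coordinates, now in the half plane of pairs (z, ρ) with ρ > 0.
        -- The half plane is encoded by an indicator so that the formula for the full plane applies;
        -- it becomes the restriction 0 < φ < π. The Jacobians `r` and `ρ = r sin φ` multiply to `r²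
        -- sin φ`.
        have e1 : ∫⁻ z : ℝ, ∫⁻ ρ in Ioi (0 : ℝ),
            ENNReal.ofReal ρ * h (z, ρ * Real.cos θ, ρ * Real.sin θ) =
            ∫⁻ q : ℝ × ℝ, (Ioi (0:ℝ)).indicator (fun _ => 1) q.2 *
              (ENNReal.ofReal q.2 * h (q.1, q.2 * Real.cos θ, q.2 * Real.sin θ)) := by
          rw [Measure.volume_eq_prod, lintegral_prod]
          · refine lintegral_congr fun z => ?_
            rw [← lintegral_indicator measurableSet_Ioi]
            refine lintegral_congr fun ρ => ?_
            by_cases hρ : ρ ∈ Ioi (0 : ℝ) <;> simp [hρ]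
          · apply Measurable.aemeasurable
            apply Measurable.mul
            · exact (measurable_const.indicator measurableSet_Ioi).comp measurable_snd
            · fun_prop
        rw [e1, ← lintegral_comp_polarCoord_symm]
        have e2 : ∀ p ∈ polarCoord.target, ENNReal.ofReal p.1 •
            ((Ioi (0:ℝ)).indicator (fun _ => (1 : ENNReal)) (polarCoord.symm p).2 *
              (ENNReal.ofReal (polarCoord.symm p).2 * h ((polarCoord.symm p).1,
                (polarCoord.symm p).2 * Real.cos θ, (polarCoord.symm p).2 * Real.sin θ))) =
            (Ioo 0 Real.pi).indicator (fun _ => (1 : ENNReal)) p.2 *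
             (ENNReal.ofReal (p.1 ^ 2 * Real.sin p.2) *
              h (p.1 * Real.cos p.2, p.1 * Real.sin p.2 * Real.cos θ,
                p.1 * Real.sin p.2 * Real.sin θ)) := by
          rintro ⟨r, φ⟩ ⟨hr, hφ⟩
          simp only [mem_Ioi, mem_Ioo] at hr hφ
          simp only [polarCoord_symm_apply, smul_eq_mul]
          by_cases h0 : 0 < φ
          · have hs : 0 < Real.sin φ := Real.sin_pos_of_pos_of_lt_pi h0 hφ.2
            rw [indicator_of_mem (by simp; positivity), indicator_of_mem (by simp [h0, hφ.2]),
              one_mul, one_mul, ← mul_assoc, ← ENNReal.ofReal_mul hr.le]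
            ring_nf
          · have hs : Real.sin φ ≤ 0 := Real.sin_nonpos_of_nonpos_of_neg_pi_le (not_lt.1 h0) hφ.1.le
            have : ¬ 0 < r * Real.sin φ := by
              have := mul_nonneg hr.le (neg_nonneg.2 hs); linarith
            rw [indicator_of_notMem (by simpa using this), indicator_of_notMem (by simp [h0])]
            simp
        rw [setLIntegral_congr_fun polarCoord.open_target.measurableSet e2, polarCoord_target,
          Measure.volume_eq_prod, ← Measure.prod_restrict, lintegral_prod_symm]
        · have e3 : ∀ φ : ℝ, ∫⁻ r in Ioi (0:ℝ), (Ioo 0 Real.pi).indicator (fun _ => (1 : ENNReal)) φ *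
             (ENNReal.ofReal (r ^ 2 * Real.sin φ) *
              h (r * Real.cos φ, r * Real.sin φ * Real.cos θ, r * Real.sin φ * Real.sin θ)) =
              (Ioo 0 Real.pi).indicator (fun φ => ∫⁻ r in Ioi (0:ℝ),
               (ENNReal.ofReal (r ^ 2 * Real.sin φ) *
              h (r * Real.cos φ, r * Real.sin φ * Real.cos θ, r * Real.sin φ * Real.sin θ))) φ := by
            intro φ
            by_cases hφ : φ ∈ Ioo 0 Real.pi <;> simp [hφ]
          simp only [e3]
          rw [setLIntegral_indicator measurableSet_Ioo, inter_eq_left.2]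
          exact Ioo_subset_Ioo_left (by linarith)
        · apply Measurable.aemeasurable
          apply Measurable.mul
          · exact (measurable_const.indicator measurableSet_Ioo).comp measurable_snd
          · fun_prop

/-- The point of the unit sphere with polar angle `p.1` and azimuth `p.2`. -/
def sph (p : ℝ × ℝ) : S2 :=
  ⟨vec (Real.cos p.1, Real.sin p.1 * Real.cos p.2, Real.sin p.1 * Real.sin p.2), by
    rw [mem_sphere_zero_iff_norm, EuclideanSpace.norm_eq, Real.sqrt_eq_one, Fin.sum_univ_three]
    simp only [vec_zero, vec_one, vec_two, Real.norm_eq_abs, sq_abs]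
    nlinarith [Real.sin_sq_add_cos_sq p.1, Real.sin_sq_add_cos_sq p.2]⟩

lemma continuous_sph : Continuous sph := by
  unfold sph
  refine Continuous.subtype_mk (continuous_vec.comp (by fun_prop)) _

lemma lintegral_sq_Ioo : ∫⁻ r in Ioo (0 : ℝ) 1, ENNReal.ofReal (r ^ 2) = 3⁻¹ := by
  rw [Measure.restrict_congr_set Ioo_ae_eq_Ioc, ← ofReal_integral_eq_lintegral_ofReal,
    ← intervalIntegral.integral_of_le zero_le_one, integral_pow]
  · rw [← ENNReal.ofReal_ofNat, ← ENNReal.ofReal_inv_of_pos (by norm_num)]; norm_num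
  · exact (continuous_pow 2).integrableOn_Ioc
  · exact Filter.Eventually.of_forall fun x => sq_nonneg x

-- The surface measure of `s` is 3 times the volume of the open cone over `s`. In spherical
-- coordinates the cone is `r < 1` with direction in `s`, so its radial integral `1/3` cancels the
-- dimension factor.
open scoped Pointwise in
lemma toSphere_apply_spherical {s : Set S2} (hs : MeasurableSet s) :
    (volume : Measure E3).toSphere s = ∫⁻ θ in Ioo (-Real.pi) Real.pi, ∫⁻ φ in Ioo 0 Real.pi,
      ENNReal.ofReal (Real.sin φ) * s.indicator (fun _ => 1) (sph (φ, θ)) := by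
  have hT : MeasurableSet (Ioo (0 : ℝ) 1 • ((↑) '' s : Set E3)) := by
    have h := (Homeomorph.measurableEmbedding
      (homeomorphUnitSphereProd E3)).measurable (hs.prod (measurableSet_Iio (a :=
        (⟨1, mem_Ioi.2 one_pos⟩ : Ioi (0:ℝ)))))
    have := (MeasurableEmbedding.subtype_coe
      (measurableSet_singleton (0 : E3)).compl).measurableSet_image.2 h
    convert this using 1
    rw [← image2_smul, image2_image_right, ← Homeomorph.image_symm, image_image,
      ← image_subtype_val_Ioi_Iio (⟨1, mem_Ioi.2 one_pos⟩ : Ioi (0:ℝ)),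
      image2_image_left, image2_swap, ← image_prod]
    rfl
  rw [Measure.toSphere_apply' _ hs, ← measurePreserving_vec.measure_preimage hT.nullMeasurableSet,
    ← lintegral_indicator_one (measurable_vec hT), lintegral_spherical]
  · have key : ∀ θ : ℝ, ∀ φ ∈ Ioo 0 Real.pi, ∫⁻ r in Ioi (0 : ℝ),
      ENNReal.ofReal (r ^ 2 * Real.sin φ) * (vec ⁻¹' (Ioo (0 : ℝ) 1 • ((↑) '' s : Set E3))).indicator 1
        (r * Real.cos φ, r * Real.sin φ * Real.cos θ, r * Real.sin φ * Real.sin θ) =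
      3⁻¹ * (ENNReal.ofReal (Real.sin φ) * s.indicator (fun _ => 1) (sph (φ, θ))) := by
      intro θ φ hφ
      have hsin : 0 < Real.sin φ := Real.sin_pos_of_pos_of_lt_pi hφ.1 hφ.2
      have hmem : ∀ r ∈ Ioi (0 : ℝ), ENNReal.ofReal (r ^ 2 * Real.sin φ) *
          (vec ⁻¹' (Ioo (0 : ℝ) 1 • ((↑) '' s : Set E3))).indicator 1
        (r * Real.cos φ, r * Real.sin φ * Real.cos θ, r * Real.sin φ * Real.sin θ) =
         (Iio (1:ℝ)).indicator (fun r => ENNReal.ofReal (r ^ 2)) r *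
          (ENNReal.ofReal (Real.sin φ) * s.indicator (fun _ => 1) (sph (φ, θ))) := by
        intro r hr
        have hr' : 0 < r := hr
        have hv : vec (r * Real.cos φ, r * Real.sin φ * Real.cos θ, r * Real.sin φ * Real.sin θ) =
            r • (sph (φ, θ) : E3) := by
          ext i; fin_cases i <;> simp [sph, mul_assoc]
        have hiff : (r * Real.cos φ, r * Real.sin φ * Real.cos θ, r * Real.sin φ * Real.sin θ) ∈
            (vec ⁻¹' (Ioo (0 : ℝ) 1 • ((↑) '' s : Set E3))) ↔ r < 1 ∧ sph (φ, θ) ∈ s := by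
          rw [mem_preimage, hv]
          constructor
          · rintro ⟨q, hq, _, ⟨v, hvs, rfl⟩, h⟩
            have hn := congrArg norm h
            simp only [norm_smul, norm_eq_of_mem_sphere, mul_one, Real.norm_eq_abs,
              abs_of_pos hq.1, abs_of_pos (mem_Ioi.1 hr)] at hn
            subst hn
            refine ⟨hq.2, ?_⟩
            have : v = sph (φ, θ) := Subtype.ext (smul_right_injective _ hq.1.ne' h)
            rwa [← this]
          · rintro ⟨h1, h2⟩
            exact ⟨r, ⟨hr, h1⟩, _, ⟨_, h2, rfl⟩, rfl⟩
        by_cases h1 : r < 1 <;> by_cases h2 : sph (φ, θ) ∈ s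
        · rw [indicator_of_mem (hiff.2 ⟨h1, h2⟩), indicator_of_mem h2,
            indicator_of_mem (show r ∈ Iio (1:ℝ) from h1), ENNReal.ofReal_mul (sq_nonneg r)]
          simp
        · rw [indicator_of_notMem (fun h => h2 (hiff.1 h).2), indicator_of_notMem h2]; simp
        · rw [indicator_of_notMem (fun h => h1 (hiff.1 h).1),
            indicator_of_notMem (show r ∉ Iio (1:ℝ) from h1)]; simp
        · rw [indicator_of_notMem (fun h => h1 (hiff.1 h).1),
            indicator_of_notMem (show r ∉ Iio (1:ℝ) from h1)]; simp
      rw [setLIntegral_congr_fun measurableSet_Ioi hmem, lintegral_mul_const _ (by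
          exact Measurable.indicator (by fun_prop) measurableSet_Iio),
        setLIntegral_indicator measurableSet_Iio, inter_comm, Ioi_inter_Iio, lintegral_sq_Ioo]
    have h2 : ∀ θ : ℝ, ∫⁻ φ in Ioo 0 Real.pi, ∫⁻ r in Ioi (0 : ℝ),
      ENNReal.ofReal (r ^ 2 * Real.sin φ) * (vec ⁻¹' (Ioo (0 : ℝ) 1 • ((↑) '' s : Set E3))).indicator 1
        (r * Real.cos φ, r * Real.sin φ * Real.cos θ, r * Real.sin φ * Real.sin θ) =
        3⁻¹ * ∫⁻ φ in Ioo 0 Real.pi,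
          (ENNReal.ofReal (Real.sin φ) * s.indicator (fun _ => 1) (sph (φ, θ))) := by
      intro θ
      rw [setLIntegral_congr_fun measurableSet_Ioo (key θ), lintegral_const_mul']
      simp
    simp only [h2]
    rw [lintegral_const_mul' _ _ (by simp), ← mul_assoc]
    have : ((Module.finrank ℝ E3 : ℕ) : ENNReal) * 3⁻¹ = 1 := by
      simp [ENNReal.mul_inv_cancel]
    rw [this, one_mul]
  · exact measurable_one.indicator (measurable_vec hT)

/-- Surface measure on the unit sphere in terms of polar angle and azimuth. -/
lemma toSphere_eq_map_sph : (volume : Measure E3).toSphere =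
    (((volume.restrict (Ioo 0 Real.pi)).prod (volume.restrict (Ioo (-Real.pi) Real.pi))).withDensity
      (fun p => ENNReal.ofReal (Real.sin p.1))).map sph := by
  ext s hs
  rw [toSphere_apply_spherical hs, Measure.map_apply continuous_sph.measurable hs,
    withDensity_apply _ (continuous_sph.measurable hs),
    ← lintegral_indicator (continuous_sph.measurable hs), lintegral_prod_symm]
  · refine lintegral_congr fun θ => lintegral_congr fun φ => ?_
    by_cases h : sph (φ, θ) ∈ s <;> simp [indicator, h]
  · refine (Measurable.indicator (by fun_prop) (continuous_sph.measurable hs)).aemeasurable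

/-! ### Symmetries of the sphere and reduction to an octant -/

-- A linear isometry maps the cone over the preimage of `s` onto the cone over `s` and preserves
-- volume, hence it preserves surface measure.
open scoped Pointwise in
lemma measurePreserving_toSphere (T : E3 ≃ₗᵢ[ℝ] E3) (g : S2 → S2) (hg : ∀ x, (g x : E3) = T x) :
    MeasurePreserving g (volume : Measure E3).toSphere (volume : Measure E3).toSphere := by
  have hgm : Continuous g := by
    refine continuous_induced_rng.2 ?_
    have : (Subtype.val ∘ g) = fun x : S2 => T x := funext hg
    rw [this]
    exact T.continuous.comp continuous_subtype_val
  refine ⟨hgm.measurable, ?_⟩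
  ext s hs
  rw [Measure.map_apply hgm.measurable hs, Measure.toSphere_apply' _ hs,
    Measure.toSphere_apply' _ (hgm.measurable hs)]
  congr 1
  rw [← (T.measurePreserving).measure_preimage_emb T.toHomeomorph.measurableEmbedding
    (Ioo (0 : ℝ) 1 • ((↑) '' s : Set E3))]
  congr 1
  ext x
  constructor
  · rintro ⟨r, hr, _, ⟨v, hv, rfl⟩, rfl⟩
    refine ⟨r, hr, _, ⟨g v, hv, rfl⟩, ?_⟩
    simp [hg]
  · rintro ⟨r, hr, _, ⟨v, hv, rfl⟩, h⟩
    have hr0 : r ≠ 0 := hr.1.ne'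
    have hx : T (r⁻¹ • x) = v := by
      rw [map_smul, ← h]; simp [smul_smul, inv_mul_cancel₀ hr0]
    have hmem : r⁻¹ • x ∈ Metric.sphere (0 : E3) 1 := by
      rw [mem_sphere_zero_iff_norm, ← T.norm_map, hx]; simp
    refine ⟨r, hr, _, ⟨⟨r⁻¹ • x, hmem⟩, ?_, rfl⟩, by simp [smul_smul, mul_inv_cancel₀ hr0]⟩
    have : g ⟨r⁻¹ • x, hmem⟩ = v := Subtype.ext (by rw [hg]; exact hx)
    simpa [this] using hv

/-- Permutation of the coordinates on the unit sphere. -/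
def permS2 (e : Equiv.Perm (Fin 3)) (U : S2) : S2 :=
  ⟨LinearIsometryEquiv.piLpCongrLeft 2 ℝ ℝ e U, by simp⟩

lemma permS2_apply (e : Equiv.Perm (Fin 3)) (U : S2) (i : Fin 3) :
    (permS2 e U : E3) (e i) = (U : E3) i := by
  simp [permS2, LinearIsometryEquiv.piLpCongrLeft_apply]

lemma measurePreserving_permS2 (e : Equiv.Perm (Fin 3)) :
    MeasurePreserving (permS2 e) uniformS2 uniformS2 := by
  have h := measurePreserving_toSphere (LinearIsometryEquiv.piLpCongrLeft 2 ℝ ℝ e) (permS2 e)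
    (fun _ => rfl)
  refine ⟨h.measurable, ?_⟩
  rw [uniformS2, Measure.map_smul, h.map_eq]

lemma integral_permS2 (e : Equiv.Perm (Fin 3)) {f : S2 → ℝ} (hf : Continuous f) :
    ∫ U, f (permS2 e U) ∂uniformS2 = ∫ U, f U ∂uniformS2 := by
  conv_rhs => rw [← (measurePreserving_permS2 e).map_eq]
  rw [integral_map (measurePreserving_permS2 e).measurable.aemeasurable
    hf.aestronglyMeasurable]

lemma integrable_of_continuous {f : S2 → ℝ} (hf : Continuous f) : Integrable f uniformS2 :=
  hf.integrable_of_hasCompactSupport (HasCompactSupport.of_compactSpace f)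

lemma toSphere_univ : (volume : Measure E3).toSphere univ = ENNReal.ofReal (4 * Real.pi) := by
  rw [toSphere_apply_spherical MeasurableSet.univ]
  simp only [indicator_univ, mul_one]
  rw [← ofReal_integral_eq_lintegral_ofReal, ← integral_Ioc_eq_integral_Ioo,
    ← intervalIntegral.integral_of_le Real.pi_pos.le, integral_sin]
  · simp only [lintegral_const, Measure.restrict_apply MeasurableSet.univ, univ_inter,
      Real.volume_Ioo]
    rw [← ENNReal.ofReal_mul (by norm_num [Real.cos_pi])]
    congr 1
    rw [Real.cos_zero, Real.cos_pi]
    ring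
  · exact (Real.continuous_sin.integrableOn_Icc).mono_set Ioo_subset_Icc_self
  · filter_upwards [ae_restrict_mem measurableSet_Ioo] with x hx
    exact Real.sin_nonneg_of_nonneg_of_le_pi hx.1.le hx.2.le

lemma integral_uniformS2 {f : S2 → ℝ} (hf : Continuous f) :
    ∫ U, f U ∂uniformS2 = (4 * Real.pi)⁻¹ * ∫ φ in 0..Real.pi, ∫ θ in (-Real.pi)..Real.pi,
      Real.sin φ * f (sph (φ, θ)) := by
  have hpi := Real.pi_pos
  rw [uniformS2, integral_smul_measure, toSphere_univ, ENNReal.toReal_inv,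
    ENNReal.toReal_ofReal (by positivity), smul_eq_mul]
  congr 1
  rw [toSphere_eq_map_sph, integral_map continuous_sph.aemeasurable hf.aestronglyMeasurable,
    integral_withDensity_eq_integral_toReal_smul (by fun_prop) (by simp),
    intervalIntegral.integral_of_le hpi.le, integral_Ioc_eq_integral_Ioo]
  have hc : Continuous fun p : ℝ × ℝ => Real.sin p.1 * f (sph p) :=
    (Real.continuous_sin.comp continuous_fst).mul (hf.comp continuous_sph)
  have hint : Integrable (fun p : ℝ × ℝ => Real.sin p.1 * f (sph p))
      ((volume.restrict (Ioo 0 Real.pi)).prod (volume.restrict (Ioo (-Real.pi) Real.pi))) := by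
    rw [Measure.prod_restrict, ← Measure.volume_eq_prod]
    exact (hc.continuousOn.integrableOn_compact (isCompact_Icc.prod isCompact_Icc)).mono_set
      (prod_mono Ioo_subset_Icc_self Ioo_subset_Icc_self)
  have hcongr : (fun p : ℝ × ℝ => (ENNReal.ofReal (Real.sin p.1)).toReal • f (sph p)) =ᵐ[
      ((volume.restrict (Ioo 0 Real.pi)).prod (volume.restrict (Ioo (-Real.pi) Real.pi)))]
      fun p : ℝ × ℝ => Real.sin p.1 * f (sph p) := by
    rw [Measure.prod_restrict]
    filter_upwards [ae_restrict_mem (measurableSet_Ioo.prod measurableSet_Ioo)] with p hp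
    rw [ENNReal.toReal_ofReal (Real.sin_nonneg_of_nonneg_of_le_pi hp.1.1.le hp.1.2.le), smul_eq_mul]
  rw [integral_congr_ae hcongr, integral_prod _ hint]
  refine setIntegral_congr_fun measurableSet_Ioo fun φ _ => ?_
  simp only
  rw [intervalIntegral.integral_of_le (by linarith), integral_Ioc_eq_integral_Ioo]

lemma integral_zero_pi_of_symm {g : ℝ → ℝ} (hg : Continuous g)
    (h : ∀ x, g (Real.pi - x) = g x) :
    ∫ x in 0..Real.pi, g x = 2 * ∫ x in 0..(Real.pi / 2), g x := by
  have h1 := intervalIntegral.integral_comp_sub_left (a := 0) (b := Real.pi / 2) g Real.pi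
  simp only [h] at h1
  rw [← intervalIntegral.integral_add_adjacent_intervals (b := Real.pi / 2)
    (hg.intervalIntegrable _ _) (hg.intervalIntegrable _ _), h1, two_mul]
  rw [show Real.pi - Real.pi / 2 = Real.pi / 2 by ring, sub_zero]

lemma integral_neg_pi_pi_of_symm {g : ℝ → ℝ} (hg : Continuous g)
    (h : ∀ x, g (Real.pi - x) = g x) (h' : ∀ x, g (-x) = g x) :
    ∫ x in (-Real.pi)..Real.pi, g x = 4 * ∫ x in 0..(Real.pi / 2), g x := by
  have h1 := intervalIntegral.integral_comp_neg (a := 0) (b := Real.pi) g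
  simp only [h'] at h1
  rw [← intervalIntegral.integral_add_adjacent_intervals (b := 0)
    (hg.intervalIntegrable _ _) (hg.intervalIntegrable _ _)]
  rw [neg_zero] at h1
  rw [← h1, integral_zero_pi_of_symm hg h]
  ring

/-- Reduction of the mean of a function with the symmetries of the coordinate planes to one
octant. -/
lemma integral_uniformS2_octant {f : S2 → ℝ} (hf : Continuous f)
    (h₁ : ∀ φ θ, f (sph (Real.pi - φ, θ)) = f (sph (φ, θ)))
    (h₂ : ∀ φ θ, f (sph (φ, Real.pi - θ)) = f (sph (φ, θ)))
    (h₃ : ∀ φ θ, f (sph (φ, -θ)) = f (sph (φ, θ))) :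
    ∫ U, f U ∂uniformS2 = 2 / Real.pi * ∫ φ in 0..(Real.pi / 2), ∫ θ in 0..(Real.pi / 2),
      Real.sin φ * f (sph (φ, θ)) := by
  have hc : Continuous fun p : ℝ × ℝ => Real.sin p.1 * f (sph p) :=
    (Real.continuous_sin.comp continuous_fst).mul (hf.comp continuous_sph)
  rw [integral_uniformS2 hf]
  have e : ∀ φ, ∫ θ in (-Real.pi)..Real.pi, Real.sin φ * f (sph (φ, θ)) =
      4 * ∫ θ in 0..(Real.pi / 2), Real.sin φ * f (sph (φ, θ)) := by
    intro φ
    refine integral_neg_pi_pi_of_symm (g := fun θ => Real.sin φ * f (sph (φ, θ)))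
      ?_ (fun θ => ?_) (fun θ => ?_)
    · exact continuous_const.mul (hf.comp (continuous_sph.comp (Continuous.prodMk_right φ)))
    · simp only [h₂]
    · simp only [h₃]
  simp only [e]
  rw [intervalIntegral.integral_const_mul, integral_zero_pi_of_symm]
  · field_simp
  · exact intervalIntegral.continuous_parametric_intervalIntegral_of_continuous'
      (f := fun φ θ => Real.sin φ * f (sph (φ, θ))) hc 0 (Real.pi / 2)
  · intro φ
    simp only [h₁, Real.sin_pi_sub]

lemma continuous_coord (i : Fin 3) : Continuous fun U : S2 => (U : E3) i := by fun_prop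

lemma exists_perm_pair : ∀ i j : Fin 3, i ≠ j → ∃ e : Equiv.Perm (Fin 3), e 0 = i ∧ e 1 = j := by
  decide

/-- Mixed means of two different coordinates do not depend on the pair of coordinates. -/
lemma integral_coord_pair {g : ℝ → ℝ → ℝ} (hg : Continuous (Function.uncurry g)) {i j : Fin 3}
    (hij : i ≠ j) : ∫ U : S2, g ((U : E3) i) ((U : E3) j) ∂uniformS2 =
      ∫ U : S2, g ((U : E3) 0) ((U : E3) 1) ∂uniformS2 := by
  obtain ⟨e, rfl, rfl⟩ := exists_perm_pair i j hij
  rw [← integral_permS2 e (f := fun U : S2 => g ((U : E3) (e 0)) ((U : E3) (e 1)))]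
  · simp only [permS2_apply]
  · exact hg.comp ((continuous_coord _).prodMk (continuous_coord _))

@[simp] lemma sph_zero (p : ℝ × ℝ) : (sph p : E3) 0 = Real.cos p.1 := rfl
@[simp] lemma sph_one (p : ℝ × ℝ) : (sph p : E3) 1 = Real.sin p.1 * Real.cos p.2 := rfl

/-- Mean of an even function of two coordinates as an integral over an octant. -/
lemma integral_coord_pair_octant {g : ℝ → ℝ → ℝ} (hg : Continuous (Function.uncurry g))
    (h₁ : ∀ x y, g (-x) y = g x y) (h₂ : ∀ x y, g x (-y) = g x y) {i j : Fin 3} (hij : i ≠ j) :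
    ∫ U : S2, g ((U : E3) i) ((U : E3) j) ∂uniformS2 =
      2 / Real.pi * ∫ φ in 0..(Real.pi / 2), ∫ θ in 0..(Real.pi / 2),
        Real.sin φ * g (Real.cos φ) (Real.sin φ * Real.cos θ) := by
  rw [integral_coord_pair hg hij, integral_uniformS2_octant]
  · simp only [sph_zero, sph_one]
  · exact hg.comp ((continuous_coord _).prodMk (continuous_coord _))
  · intro φ θ; simp [h₁]
  · intro φ θ; simp [h₂]
  · intro φ θ; simp

/-! ### Means of products of coordinate functions -/

lemma sin_cos_nonneg {x : ℝ} (hx : x ∈ uIcc 0 (Real.pi / 2)) : 0 ≤ Real.sin x ∧ 0 ≤ Real.cos x := by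
  have hpi := Real.pi_pos
  rw [uIcc_of_le (by linarith)] at hx
  exact ⟨Real.sin_nonneg_of_nonneg_of_le_pi hx.1 (by linarith [hx.2]),
    Real.cos_nonneg_of_neg_pi_div_two_le_of_le (by linarith [hx.1]) hx.2⟩

/-- Mean of an even function of two coordinates which splits as a product over the octant. -/
lemma integral_coord_pair_of_mul {g : ℝ → ℝ → ℝ} (hg : Continuous (Function.uncurry g))
    (h₁ : ∀ x y, g (-x) y = g x y) (h₂ : ∀ x y, g x (-y) = g x y) {i j : Fin 3} (hij : i ≠ j)
    (a b : ℝ → ℝ) (hab : ∀ φ ∈ uIcc 0 (Real.pi / 2), ∀ θ ∈ uIcc 0 (Real.pi / 2),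
      Real.sin φ * g (Real.cos φ) (Real.sin φ * Real.cos θ) = a φ * b θ) :
    ∫ U : S2, g ((U : E3) i) ((U : E3) j) ∂uniformS2 =
      2 / Real.pi * ((∫ φ in 0..(Real.pi / 2), a φ) * ∫ θ in 0..(Real.pi / 2), b θ) := by
  rw [integral_coord_pair_octant hg h₁ h₂ hij, ← intervalIntegral.integral_mul_const]
  congr 1
  refine intervalIntegral.integral_congr fun φ hφ => ?_
  rw [← intervalIntegral.integral_const_mul]
  exact intervalIntegral.integral_congr fun θ hθ => hab φ hφ θ hθ

lemma sqrt_one_sub_cos_sq {φ : ℝ} (h : 0 ≤ Real.sin φ) :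
    Real.sqrt (1 - Real.cos φ ^ 2) = Real.sin φ := by
  rw [← Real.sin_sq, Real.sqrt_sq h]

lemma fin3_ne_succ (i : Fin 3) : i ≠ i + 1 := by decide +revert

lemma mean_abs_coord (i : Fin 3) : ∫ U : S2, |(U : E3) i| ∂uniformS2 = 1 / 2 := by
  rw [integral_coord_pair_of_mul (g := fun x _ => |x|) (by fun_prop) (by simp) (by simp)
    (fin3_ne_succ i) (fun φ => Real.sin φ * Real.cos φ) (fun _ => 1)]
  · rw [integral_sin_mul_cos₁]
    have := Real.pi_pos
    simp
    field_simp
  · intro φ hφ θ _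
    simp [abs_of_nonneg (sin_cos_nonneg hφ).2]

lemma mean_sqrt_coord (i : Fin 3) :
    ∫ U : S2, Real.sqrt (1 - (U : E3) i ^ 2) ∂uniformS2 = Real.pi / 4 := by
  rw [integral_coord_pair_of_mul (g := fun x _ => Real.sqrt (1 - x ^ 2)) (by fun_prop) (by simp)
    (by simp) (fin3_ne_succ i) (fun φ => Real.sin φ ^ 2) (fun _ => 1)]
  · rw [integral_sin_sq]
    have := Real.pi_pos
    simp
    field_simp
    norm_num
  · intro φ hφ θ _
    simp only [sqrt_one_sub_cos_sq (sin_cos_nonneg hφ).1]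
    ring

lemma integral_sin_sq_mul_cos_quarter :
    ∫ φ in 0..(Real.pi / 2), Real.sin φ ^ 2 * Real.cos φ = 1 / 3 := by
  simp

lemma mean_abs_mul_abs {i j : Fin 3} (hij : i ≠ j) :
    ∫ U : S2, |(U : E3) i| * |(U : E3) j| ∂uniformS2 = 2 / (3 * Real.pi) := by
  rw [integral_coord_pair_of_mul (g := fun x y => |x| * |y|) (by fun_prop) (by simp)
    (by simp) hij (fun φ => Real.sin φ ^ 2 * Real.cos φ) (fun θ => Real.cos θ)]
  · rw [integral_sin_sq_mul_cos_quarter, integral_cos]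
    simp
    field_simp
  · intro φ hφ θ hθ
    obtain ⟨h1, h2⟩ := sin_cos_nonneg hφ
    simp only [abs_mul, abs_of_nonneg h1, abs_of_nonneg h2, abs_of_nonneg (sin_cos_nonneg hθ).2]
    ring

lemma mean_abs_mul_sqrt_self (i : Fin 3) :
    ∫ U : S2, |(U : E3) i| * Real.sqrt (1 - (U : E3) i ^ 2) ∂uniformS2 = 1 / 3 := by
  rw [integral_coord_pair_of_mul (g := fun x _ => |x| * Real.sqrt (1 - x ^ 2)) (by fun_prop)
    (by simp) (by simp) (fin3_ne_succ i) (fun φ => Real.sin φ ^ 2 * Real.cos φ) (fun _ => 1)]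
  · rw [integral_sin_sq_mul_cos_quarter]
    have := Real.pi_pos
    simp
    field_simp
  · intro φ hφ θ hθ
    obtain ⟨h1, h2⟩ := sin_cos_nonneg hφ
    simp only [sqrt_one_sub_cos_sq h1, abs_of_nonneg h2]
    ring

lemma mean_abs_mul_sqrt {i j : Fin 3} (hij : i ≠ j) :
    ∫ U : S2, |(U : E3) j| * Real.sqrt (1 - (U : E3) i ^ 2) ∂uniformS2 = 4 / (3 * Real.pi) := by
  rw [integral_coord_pair_of_mul (g := fun x y => |y| * Real.sqrt (1 - x ^ 2)) (by fun_prop)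
    (by simp) (by simp) hij (fun φ => Real.sin φ ^ 3) (fun θ => Real.cos θ)]
  · have := integral_sin_pow_odd_mul_cos_pow (a := 0) (b := Real.pi / 2) 1 0
    simp at this
    rw [this, integral_cos]
    simp
    field_simp
    norm_num
  · intro φ hφ θ hθ
    obtain ⟨h1, h2⟩ := sin_cos_nonneg hφ
    simp only [sqrt_one_sub_cos_sq h1, abs_mul, abs_of_nonneg h1,
      abs_of_nonneg (sin_cos_nonneg hθ).2]
    ring

/-- With polar axis `i`, one root is `sin φ` and joins the Jacobian to give `sin² φ`; the other is
`√(1 - sin² φ cos² θ)`, whose θ-integral is the elliptic integral after the reflection `θ ↦ π/2 -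
θ`. This is the only mean that does not split as a product. -/
lemma mean_sqrt_mul_sqrt {i j : Fin 3} (hij : i ≠ j) :
    ∫ U : S2, Real.sqrt (1 - (U : E3) i ^ 2) * Real.sqrt (1 - (U : E3) j ^ 2) ∂uniformS2 =
      2 / Real.pi * ∫ φ in 0..(Real.pi / 2), ellipticE (Real.sin φ) * Real.sin φ ^ 2 := by
  rw [integral_coord_pair_octant (g := fun x y => Real.sqrt (1 - x ^ 2) * Real.sqrt (1 - y ^ 2))
    (by fun_prop) (by simp) (by simp) hij]
  congr 1
  refine intervalIntegral.integral_congr fun φ hφ => ?_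
  have h1 := (sin_cos_nonneg hφ).1
  simp only [sqrt_one_sub_cos_sq h1, ellipticE]
  have := intervalIntegral.integral_comp_sub_left (a := 0) (b := Real.pi / 2)
    (fun θ => Real.sqrt (1 - Real.sin φ ^ 2 * Real.sin θ ^ 2)) (Real.pi / 2)
  simp only [Real.sin_pi_div_two_sub, sub_self, sub_zero] at this
  rw [← this, ← intervalIntegral.integral_mul_const]
  refine intervalIntegral.integral_congr fun θ _ => ?_
  simp only [mul_pow]
  ring

/-! ### The hypergeometric series: convergence and a numerical enclosure -/

/-- The terms of `₃F₂(-1/2, 1/2, 3/2; 1, 2; 1)`, normalized to start with `1`. -/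
def hypCoeff : ℕ → ℝ
  | 0 => 1
  | k + 1 => hypCoeff k *
      ((2 * k - 1) * (2 * k + 1) * (2 * k + 3) / (8 * (k + 1) ^ 2 * (k + 2)))

lemma hypCoeff_succ (k : ℕ) : hypCoeff (k + 1) = hypCoeff k *
    ((2 * k - 1) * (2 * k + 1) * (2 * k + 3) / (8 * (k + 1) ^ 2 * (k + 2))) := rfl

lemma gamma_norm_ne_zero :
    Real.Gamma (-1 / 2) * Real.Gamma (1 / 2) * Real.Gamma (3 / 2) ≠ 0 := by
  have h1 : Real.Gamma (-1 / 2) ≠ 0 := by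
    refine Real.Gamma_ne_zero fun m hm => ?_
    have h2 : (2 * m : ℝ) = 1 := by linarith
    have h3 : 2 * m = 1 := by exact_mod_cast h2
    omega
  have h2 := Real.Gamma_pos_of_pos (s := 1 / 2) (by norm_num)
  have h3 := Real.Gamma_pos_of_pos (s := 3 / 2) (by norm_num)
  positivity

lemma hyp3F2Term_eq (k : ℕ) : hyp3F2Term (-1 / 2) (1 / 2) (3 / 2) 1 2 1 k =
    Real.Gamma (-1 / 2) * Real.Gamma (1 / 2) * Real.Gamma (3 / 2) * hypCoeff k := by
  induction k with
  | zero => simp [hyp3F2Term, hypCoeff]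
  | succ k ih =>
    have hk : (0 : ℝ) ≤ k := k.cast_nonneg
    have hne : (-1 / 2 + k : ℝ) ≠ 0 := by
      intro h
      have h2 : (2 * k : ℝ) = 1 := by linarith
      have h3 : 2 * k = 1 := by exact_mod_cast h2
      omega
    rw [hypCoeff, ← mul_assoc, ← ih]
    simp only [hyp3F2Term, one_pow, Nat.factorial_succ]
    push_cast
    simp only [← add_assoc]
    rw [Real.Gamma_add_one hne, Real.Gamma_add_one (s := 1 / 2 + k) (by positivity),
      Real.Gamma_add_one (s := 3 / 2 + k) (by positivity),
      Real.Gamma_add_one (s := 1 + k) (by positivity),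
      Real.Gamma_add_one (s := 2 + k) (by positivity)]
    have g1 := (Real.Gamma_pos_of_pos (s := 1 + k) (by positivity)).ne'
    have g2 := (Real.Gamma_pos_of_pos (s := 2 + k) (by positivity)).ne'
    have g3 : (k.factorial : ℝ) ≠ 0 := by positivity
    field_simp
    ring

lemma hyp3F2_eq : hyp3F2 (-1 / 2) (1 / 2) (3 / 2) 1 2 1 = ∑' k, hypCoeff k := by
  rw [hyp3F2]
  simp only [hyp3F2Term_eq, tsum_mul_left]
  rw [← mul_assoc, div_mul_cancel₀ _ gamma_norm_ne_zero]
  simp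

/-- Only the ratio at index 0 is negative, so all terms after the first share one sign. The tail
estimates below depend on this sign. -/
lemma hypCoeff_succ_nonpos (k : ℕ) : hypCoeff (k + 1) ≤ 0 := by
  induction k with
  | zero => norm_num [hypCoeff]
  | succ k ih =>
    rw [hypCoeff]
    refine mul_nonpos_of_nonpos_of_nonneg ih ?_
    push_cast
    have : (0 : ℝ) ≤ k := k.cast_nonneg
    have : (0 : ℝ) ≤ 2 * (k + 1) - 1 := by linarith
    positivity

/-- The ratio of consecutive terms is `1 - (5/2)/k + O(k⁻²)`, so the true decay is `k^(-5/2)`. The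
weaker exponent 2 suffices for summability, and the induction then compares rational functions;
`3/16` is the modulus of the term of index 1. -/
lemma abs_hypCoeff_le (k : ℕ) : |hypCoeff (k + 1)| ≤ 3 / 16 / ((k : ℝ) + 1) ^ 2 := by
  rw [abs_of_nonpos (hypCoeff_succ_nonpos k)]
  induction k with
  | zero => norm_num [hypCoeff]
  | succ k ih =>
    have hk : (0 : ℝ) ≤ k := k.cast_nonneg
    have h0 : (0 : ℝ) ≤ 2 * (k + 1) - 1 := by linarith
    rw [hypCoeff, ← neg_mul]
    push_cast
    calc _ ≤ 3 / 16 / ((k : ℝ) + 1) ^ 2 * ((2 * (k + 1) - 1) * (2 * (k + 1) + 1) *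
          (2 * (k + 1) + 3) / (8 * (k + 1 + 1) ^ 2 * (k + 1 + 2))) :=
          mul_le_mul_of_nonneg_right ih (by positivity)
      _ ≤ _ := by
        rw [div_mul_div_comm, div_le_div_iff₀ (by positivity) (by positivity), ← sub_nonneg]
        ring_nf
        positivity

lemma summable_hypCoeff : Summable hypCoeff := by
  rw [← summable_nat_add_iff 1]
  refine Summable.of_norm_bounded (g := fun k : ℕ => 3 / 16 / ((k : ℝ) + 1) ^ 2) ?_ abs_hypCoeff_le
  have h := ((summable_nat_add_iff 1).2 (Real.summable_nat_pow_inv (p := 2).2 one_lt_two)).mul_left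
    (3 / 16 : ℝ)
  refine h.congr fun k => ?_
  rw [div_eq_mul_inv (3 / 16 : ℝ)]
  push_cast
  rfl

lemma summable_hyp3F2Term : Summable (hyp3F2Term (-1 / 2) (1 / 2) (3 / 2) 1 2 1) := by
  have : hyp3F2Term (-1 / 2) (1 / 2) (3 / 2) 1 2 1 = fun k =>
    Real.Gamma (-1 / 2) * Real.Gamma (1 / 2) * Real.Gamma (3 / 2) * hypCoeff k :=
    funext hyp3F2Term_eq
  rw [this]
  exact summable_hypCoeff.mul_left _

/-- Approximate ratio of the tail of the series from index `k` on to its `k`-th term. -/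
def tailRatio (c : ℝ) (k : ℕ) : ℝ :=
  (2 / 3 * (k : ℝ) ^ 6 + 3 / 5 * (k : ℝ) ^ 5 + 1 / 35 * (k : ℝ) ^ 4 + 1 / 28 * (k : ℝ) ^ 3
    - 131 / 3080 * (k : ℝ) ^ 2 + 307 / 20020 * (k : ℝ) + c) / (k : ℝ) ^ 5

-- Boundary term at infinity of the telescoping argument: the terms are `O(k⁻²)` and `tailRatio`
-- grows linearly.
open Filter Topology in
lemma tendsto_hypCoeff_mul_tailRatio (c : ℝ) :
    Tendsto (fun k => hypCoeff k * tailRatio c k) atTop (𝓝 0) := by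
  -- The shift avoids index 0, where `tailRatio` divides by zero.
  rw [← tendsto_add_atTop_iff_nat 1]
  have hlim : Tendsto (fun k : ℕ => 3 / 16 * (2 + |c|) * (1 / ((k : ℝ) + 1))) atTop (𝓝 0) := by
    simpa using (tendsto_one_div_add_atTop_nhds_zero_nat (𝕜 := ℝ)).const_mul (3 / 16 * (2 + |c|))
  refine squeeze_zero_norm (fun k => ?_) hlim
  have hk : (0 : ℝ) ≤ k := k.cast_nonneg
  -- The absolute values of the six fixed coefficients add up to less than 2.
  have hR : |tailRatio c (k + 1)| ≤ (2 + |c|) * ((k : ℝ) + 1) := by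
    have hx : (1 : ℝ) ≤ (k : ℝ) + 1 := by linarith
    rw [tailRatio]
    push_cast
    set x : ℝ := (k : ℝ) + 1
    have hx0 : 0 < x := by linarith
    rw [abs_div, abs_of_pos (show 0 < x ^ 5 by positivity), div_le_iff₀ (by positivity)]
    have h1 : x ^ 1 ≤ x ^ 6 := pow_le_pow_right₀ hx (by norm_num)
    have h2 : x ^ 2 ≤ x ^ 6 := pow_le_pow_right₀ hx (by norm_num)
    have h3 : x ^ 3 ≤ x ^ 6 := pow_le_pow_right₀ hx (by norm_num)
    have h4 : x ^ 4 ≤ x ^ 6 := pow_le_pow_right₀ hx (by norm_num)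
    have h5 : x ^ 5 ≤ x ^ 6 := pow_le_pow_right₀ hx (by norm_num)
    have h0 : 1 ≤ x ^ 6 := one_le_pow₀ hx
    have hc : |c| ≤ |c| * x ^ 6 := le_mul_of_one_le_right (abs_nonneg c) h0
    have e : (2 + |c|) * x * x ^ 5 = 2 * x ^ 6 + |c| * x ^ 6 := by ring
    rw [pow_one] at h1
    have p3 : 0 ≤ x ^ 3 := by positivity
    have p4 : 0 ≤ x ^ 4 := by positivity
    have p5 : 0 ≤ x ^ 5 := by positivity
    have p2 : 0 ≤ x ^ 2 := by positivity
    rw [e, abs_le]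
    constructor <;> linarith [neg_abs_le c, le_abs_self c]
  rw [norm_mul, Real.norm_eq_abs, Real.norm_eq_abs]
  calc _ ≤ 3 / 16 / ((k : ℝ) + 1) ^ 2 * ((2 + |c|) * ((k : ℝ) + 1)) :=
        mul_le_mul (abs_hypCoeff_le k) hR (abs_nonneg _) (by positivity)
    _ = _ := by field_simp

lemma tsum_telescope_le {v g : ℕ → ℝ} (hv : Summable v) (hg : Filter.Tendsto g .atTop (nhds 0))
    (h : ∀ k, v k ≤ g k - g (k + 1)) : ∑' k, v k ≤ g 0 := by
  refine le_of_tendsto_of_tendsto' hv.hasSum.tendsto_sum_nat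
    (b := Filter.atTop) (g := fun n => g 0 - g n) ?_ fun n => ?_
  · simpa using hg.const_sub (g 0)
  · rw [← Finset.sum_range_sub' g n]
    exact Finset.sum_le_sum fun k _ => h k

/-- If `r k` is the ratio of consecutive terms, the exact quotient `T k` of tail by term satisfies
`T k - r k * T (k + 1) = 1`. The numerator of `tailRatio` lists the coefficients of the large-`k`
expansion of `T`; the constants `131/14560` here and `-7/640` in `le_tailRatio_sub` in the last
place make the truncation a super- and a subsolution. From index 1 on, clearing denominators leaves
a polynomial in `k` with nonnegative coefficients. -/
lemma tailRatio_sub_le (k : ℕ) : 1 ≤ tailRatio (131 / 14560) (k + 1) -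
    (2 * (k + 1) - 1) * (2 * (k + 1) + 1) * (2 * (k + 1) + 3) / (8 * (k + 1 + 1) ^ 2 * (k + 1 + 2)) *
      tailRatio (131 / 14560) (k + 2) := by
  have hk : (0 : ℝ) ≤ k := k.cast_nonneg
  rw [tailRatio, tailRatio]
  push_cast
  rw [← sub_nonneg, div_mul_div_comm, div_sub_div _ _ (by positivity) (by positivity),
    div_sub_one (by positivity)]
  refine div_nonneg ?_ (by positivity)
  ring_nf
  positivity

lemma le_tailRatio_sub (k : ℕ) : tailRatio (-7 / 640) (k + 1) -
    (2 * (k + 1) - 1) * (2 * (k + 1) + 1) * (2 * (k + 1) + 3) / (8 * (k + 1 + 1) ^ 2 * (k + 1 + 2)) *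
      tailRatio (-7 / 640) (k + 2) ≤ 1 := by
  have hk : (0 : ℝ) ≤ k := k.cast_nonneg
  rw [tailRatio, tailRatio]
  push_cast
  rw [← sub_nonneg, div_mul_div_comm, div_sub_div _ _ (by positivity) (by positivity),
    one_sub_div (by positivity)]
  refine div_nonneg ?_ (by positivity)
  ring_nf
  positivity

/-- Multiplying the inequality of `tailRatio_sub_le` by a term, which is nonpositive, reverses it
and makes the tail telescope. Hence the larger constant yields the lower bound, and in
`tsum_hypCoeff_le` the smaller one yields the upper bound. -/
lemma le_tsum_hypCoeff (N : ℕ) : ∑ k ∈ Finset.range (N + 1), hypCoeff k +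
    hypCoeff (N + 1) * tailRatio (131 / 14560) (N + 1) ≤ ∑' k, hypCoeff k := by
  rw [← summable_hypCoeff.sum_add_tsum_nat_add (N + 1)]
  have hs := (summable_nat_add_iff (N + 1)).2 summable_hypCoeff
  have ht := (Filter.tendsto_add_atTop_iff_nat (N + 1)).2
    (tendsto_hypCoeff_mul_tailRatio (131 / 14560))
  have := tsum_telescope_le (v := fun k => -hypCoeff (k + (N + 1)))
    (g := fun k => -(hypCoeff (k + (N + 1)) * tailRatio (131 / 14560) (k + (N + 1))))
    hs.neg (by simpa using ht.neg) (fun k => ?_)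
  · simp only [zero_add, tsum_neg] at this
    linarith
  · have h1 := hypCoeff_succ_nonpos (k + N)
    have h2 := tailRatio_sub_le (k + N)
    rw [show k + 1 + (N + 1) = k + N + 1 + 1 by ring, show k + (N + 1) = k + N + 1 by ring]
    have h3 := hypCoeff_succ (k + N + 1)
    push_cast at h2 h3 ⊢
    rw [h3]
    have := mul_le_mul_of_nonneg_left h2 (neg_nonneg.2 h1)
    linarith

lemma tsum_hypCoeff_le (N : ℕ) : ∑' k, hypCoeff k ≤ ∑ k ∈ Finset.range (N + 1), hypCoeff k +
    hypCoeff (N + 1) * tailRatio (-7 / 640) (N + 1) := by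
  rw [← summable_hypCoeff.sum_add_tsum_nat_add (N + 1)]
  have hs := (summable_nat_add_iff (N + 1)).2 summable_hypCoeff
  have ht := (Filter.tendsto_add_atTop_iff_nat (N + 1)).2
    (tendsto_hypCoeff_mul_tailRatio (-7 / 640))
  have := tsum_telescope_le (v := fun k => hypCoeff (k + (N + 1)))
    (g := fun k => (hypCoeff (k + (N + 1)) * tailRatio (-7 / 640) (k + (N + 1))))
    hs (by simpa using ht) (fun k => ?_)
  · simp only [zero_add] at this
    linarith
  · have h1 := hypCoeff_succ_nonpos (k + N)
    have h2 := le_tailRatio_sub (k + N)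
    rw [show k + 1 + (N + 1) = k + N + 1 + 1 by ring, show k + (N + 1) = k + N + 1 by ring]
    have h3 := hypCoeff_succ (k + N + 1)
    push_cast at h2 h3 ⊢
    rw [h3]
    have := mul_le_mul_of_nonneg_left h2 (neg_nonneg.2 h1)
    linarith

/-- Numerator and denominator of the `k`-th term of the series, and numerator of the sum of the
terms before it over the same denominator. -/
def hypNum : ℕ → ℤ × ℤ × ℤ
  | 0 => (1, 1, 0)
  | k + 1 =>
    let s := hypNum k
    let b : ℤ := 8 * (k + 1) ^ 2 * (k + 2)
    (s.1 * ((2 * k - 1) * (2 * k + 1) * (2 * k + 3)), s.2.1 * b, (s.2.2 + s.1) * b)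

lemma hypNum_spec (k : ℕ) : 0 < (hypNum k).2.1 ∧
    hypCoeff k = (hypNum k).1 / (hypNum k).2.1 ∧
    ∑ j ∈ Finset.range k, hypCoeff j = (hypNum k).2.2 / (hypNum k).2.1 := by
  induction k with
  | zero => simp [hypNum, hypCoeff]
  | succ k ih =>
    obtain ⟨h1, h2, h3⟩ := ih
    have h1' : (0 : ℝ) < ((hypNum k).2.1 : ℝ) := by exact_mod_cast h1
    have hk : (0 : ℝ) ≤ k := k.cast_nonneg
    refine ⟨?_, ?_, ?_⟩
    · simp only [hypNum]; positivity
    · rw [hypCoeff_succ, h2]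
      simp only [hypNum]
      push_cast
      rw [div_mul_div_comm]
    · rw [Finset.sum_range_succ, h2, h3, ← add_div]
      simp only [hypNum]
      push_cast
      rw [mul_div_mul_right _ _ (by positivity)]

/-- The bound of `le_tsum_hypCoeff` for 100 summed terms with all denominators cleared: the quotient
of the two long constants is `tailRatio (131 / 14560) 100`. Carrying unreduced integers lets the
kernel decide it without computing any gcd. -/
lemma hypNum_lower : 755302538303896612 * ((hypNum 100).2.1 * 436800000000000) ≤
    ((hypNum 100).2.2 * 436800000000000 + (hypNum 100).1 * 29382206341489193) * 10 ^ 18 := by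
  decide +kernel

lemma hypNum_upper : ((hypNum 100).2.2 * 1747200000000000 +
    (hypNum 100).1 * 117528825365953289) * 10 ^ 18 ≤
    755302538303896620 * ((hypNum 100).2.1 * 1747200000000000) := by
  decide +kernel

lemma decimal_le_tsum_hypCoeff : 0.755302538303896612 ≤ ∑' k, hypCoeff k := by
  refine le_trans ?_ (le_tsum_hypCoeff 99)
  obtain ⟨h1, h2, h3⟩ := hypNum_spec 100
  have h1' : (0 : ℝ) < ((hypNum 100).2.1 : ℝ) := by exact_mod_cast h1
  have h4 : (755302538303896612 * ((hypNum 100).2.1 * 436800000000000) : ℝ) ≤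
    ((hypNum 100).2.2 * 436800000000000 + (hypNum 100).1 * 29382206341489193) * 10 ^ 18 := by
    exact_mod_cast hypNum_lower
  have e : tailRatio (131 / 14560) 100 = 29382206341489193 / 436800000000000 := by
    norm_num [tailRatio]
  rw [show 99 + 1 = 100 from rfl, h2, h3, e, div_mul_div_comm, div_add_div _ _ h1'.ne' (by positivity),
    le_div_iff₀ (by positivity)]
  have := mul_le_mul_of_nonneg_left h4 h1'.le
  norm_num at this ⊢
  linarith

lemma tsum_hypCoeff_le_decimal : ∑' k, hypCoeff k ≤ 0.755302538303896620 := by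
  refine le_trans (tsum_hypCoeff_le 99) ?_
  obtain ⟨h1, h2, h3⟩ := hypNum_spec 100
  have h1' : (0 : ℝ) < ((hypNum 100).2.1 : ℝ) := by exact_mod_cast h1
  have h4 : ((hypNum 100).2.2 * 1747200000000000 +
    (hypNum 100).1 * 117528825365953289) * 10 ^ 18 ≤
    (755302538303896620 * ((hypNum 100).2.1 * 1747200000000000) : ℝ) := by
    exact_mod_cast hypNum_upper
  have e : tailRatio (-7 / 640) 100 = 117528825365953289 / 1747200000000000 := by
    norm_num [tailRatio]
  rw [show 99 + 1 = 100 from rfl, h2, h3, e, div_mul_div_comm, div_add_div _ _ h1'.ne' (by positivity),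
    div_le_iff₀ (by positivity)]
  have := mul_le_mul_of_nonneg_left h4 h1'.le
  norm_num at this ⊢
  linarith

/-! ### The elliptic integral as a hypergeometric series -/

/-- Taylor coefficients of `√(1 - x)`. -/
def sqrtCoeff : ℕ → ℝ
  | 0 => 1
  | k + 1 => sqrtCoeff k * ((2 * k - 1) / (2 * (k + 1)))

lemma choose_half_succ (n : ℕ) : Ring.choose (1 / 2 : ℝ) (n + 1) =
    Ring.choose (1 / 2 : ℝ) n * ((1 / 2 - n) / (n + 1)) := by
  have h : (descPochhammer ℤ (n + 1)).smeval (1 / 2 : ℝ) =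
      (descPochhammer ℤ n).smeval (1 / 2 : ℝ) * (1 / 2 - n) := by
    rw [descPochhammer_succ_right, Polynomial.smeval_mul]
    simp [Polynomial.smeval_sub, Polynomial.smeval_natCast]
  rw [Ring.choose_eq_smul, Ring.choose_eq_smul, h, Nat.factorial_succ]
  have : (n.factorial : ℝ) ≠ 0 := by positivity
  simp only [smul_eq_mul]
  push_cast
  field_simp

lemma choose_half_eq (n : ℕ) : Ring.choose (1 / 2 : ℝ) n * (-1) ^ n = sqrtCoeff n := by
  induction n with
  | zero => simp [sqrtCoeff]
  | succ n ih =>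
    rw [choose_half_succ, sqrtCoeff, ← ih]
    field_simp
    ring

lemma hasSum_sqrt_one_sub {x : ℝ} (hx : |x| < 1) :
    HasSum (fun n => sqrtCoeff n * x ^ n) (Real.sqrt (1 - x)) := by
  have h := (Real.one_add_rpow_hasFPowerSeriesOnBall_zero (a := 1 / 2)).hasSum (y := -x)
    (by simpa [Metric.mem_eball, edist_dist] using hx)
  rw [Real.sqrt_eq_rpow, sub_eq_add_neg]
  simp only [zero_add] at h
  refine h.congr_fun fun n => ?_
  rw [binomialSeries_apply, ← choose_half_eq, smul_eq_mul, List.ofFn_const, List.prod_replicate,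
    mul_assoc, ← mul_pow, neg_one_mul]

/-- Normalized Wallis integrals. -/
def wallisCoeff (n : ℕ) : ℝ := ∏ i ∈ Finset.range n, (2 * (i : ℝ) + 1) / (2 * i + 2)

lemma integral_sin_pow_quarter (n : ℕ) :
    ∫ x in 0..(Real.pi / 2), Real.sin x ^ (2 * n) = Real.pi / 2 * wallisCoeff n := by
  have h := integral_zero_pi_of_symm (g := fun x => Real.sin x ^ (2 * n)) (by fun_prop) (by simp)
  rw [integral_sin_pow_even] at h
  rw [wallisCoeff]
  linarith

/-- The three ratios `(2n-1)/(2n+2)`, `(2n+3)/(2n+4)` and `(2n+1)/(2n+2)` multiply to the ratio of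
the hypergeometric terms; the factor `1/2` is the Wallis coefficient of index 1. -/
lemma sqrtCoeff_mul_wallisCoeff (n : ℕ) :
    sqrtCoeff n * (wallisCoeff (n + 1) * wallisCoeff n) = hypCoeff n / 2 := by
  induction n with
  | zero => simp [sqrtCoeff, wallisCoeff, hypCoeff]
  | succ n ih =>
    have hw : ∀ m, wallisCoeff (m + 1) = wallisCoeff m * ((2 * (m : ℝ) + 1) / (2 * m + 2)) :=
      fun m => Finset.prod_range_succ _ m
    have h : hypCoeff n = 2 * (sqrtCoeff n * (wallisCoeff (n + 1) * wallisCoeff n)) := by linarith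
    rw [hypCoeff, h, sqrtCoeff, hw (n + 1), hw n]
    have : (n : ℝ) + 1 ≠ 0 := by positivity
    have : (n : ℝ) + 2 ≠ 0 := by positivity
    push_cast
    field_simp
    ring

lemma wallisCoeff_pos (n : ℕ) : 0 < wallisCoeff n :=
  Finset.prod_pos fun i _ => by positivity

/-- Expand `√(1 - sin² φ sin² θ)` in powers of `sin² φ sin² θ` and integrate over the square
termwise. The extra `sin² φ` shifts one Wallis index by one, and the summability of the absolute
hypergeometric terms justifies the interchange. -/
lemma ellipticE_integral :
    ∫ φ in (0 : ℝ)..(Real.pi / 2), ellipticE (Real.sin φ) * Real.sin φ ^ 2 =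
      Real.pi ^ 2 / 8 * ∑' k, hypCoeff k := by
  have hpi := Real.pi_pos
  set I := Ioo 0 (Real.pi / 2) with hI
  set μ := (volume.restrict I).prod (volume.restrict I) with hμ
  have hconv : ∀ f : ℝ → ℝ, ∫ x in I, f x = ∫ x in 0..(Real.pi / 2), f x := fun f => by
    rw [intervalIntegral.integral_of_le (by linarith), integral_Ioc_eq_integral_Ioo]
  have hint : ∀ f : ℝ × ℝ → ℝ, Continuous f → Integrable f μ := fun f hf => by
    rw [hμ, Measure.prod_restrict, ← Measure.volume_eq_prod]
    exact (hf.continuousOn.integrableOn_compact (isCompact_Icc.prod isCompact_Icc)).mono_set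
      (prod_mono Ioo_subset_Icc_self Ioo_subset_Icc_self)
  let F : ℕ → ℝ × ℝ → ℝ := fun n p =>
    sqrtCoeff n * (Real.sin p.1 ^ (2 * (n + 1)) * Real.sin p.2 ^ (2 * n))
  have hF : ∀ n, ∫ p, F n p ∂μ = Real.pi ^ 2 / 8 * hypCoeff n := by
    intro n
    rw [integral_const_mul, integral_prod_mul (fun x => Real.sin x ^ (2 * (n + 1)))
      (fun x => Real.sin x ^ (2 * n)), hconv, hconv, integral_sin_pow_quarter,
      integral_sin_pow_quarter]
    have := sqrtCoeff_mul_wallisCoeff n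
    linear_combination Real.pi ^ 2 / 4 * this
  have hFn : ∀ n, ∫ p, ‖F n p‖ ∂μ = Real.pi ^ 2 / 8 * |hypCoeff n| := by
    intro n
    have e : ∀ p, ‖F n p‖ = |sqrtCoeff n| *
        (Real.sin p.1 ^ (2 * (n + 1)) * Real.sin p.2 ^ (2 * n)) := fun p => by
      have hp : 0 ≤ Real.sin p.1 ^ (2 * (n + 1)) * Real.sin p.2 ^ (2 * n) := by
        rw [pow_mul, pow_mul]
        positivity
      rw [Real.norm_eq_abs, abs_mul, abs_of_nonneg hp]
    simp only [e]
    rw [integral_const_mul, integral_prod_mul (fun x => Real.sin x ^ (2 * (n + 1)))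
      (fun x => Real.sin x ^ (2 * n)), hconv, hconv, integral_sin_pow_quarter,
      integral_sin_pow_quarter]
    have := congrArg abs (sqrtCoeff_mul_wallisCoeff n)
    rw [abs_mul, abs_of_pos (mul_pos (wallisCoeff_pos _) (wallisCoeff_pos _)), abs_div,
      abs_two] at this
    linear_combination Real.pi ^ 2 / 4 * this
  have hsum := hasSum_integral_of_summable_integral_norm (F := F) (μ := μ)
    (fun n => hint _ (by fun_prop)) (by
      simp only [hFn]
      exact summable_hypCoeff.abs.mul_left _)
  simp only [hF] at hsum
  rw [← tsum_mul_left, hsum.tsum_eq]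
  have hae : (fun p => ∑' n, F n p) =ᵐ[μ] fun p =>
      Real.sqrt (1 - Real.sin p.1 ^ 2 * Real.sin p.2 ^ 2) * Real.sin p.1 ^ 2 := by
    rw [hμ, Measure.prod_restrict]
    filter_upwards [ae_restrict_mem (measurableSet_Ioo.prod measurableSet_Ioo)] with p hp
    -- The binomial series is used only inside its disc of convergence, which is why the square is
    -- taken open.
    have h1 : Real.sin p.1 < 1 := by
      rw [← Real.sin_pi_div_two]
      exact Real.sin_lt_sin_of_lt_of_le_pi_div_two (by linarith [hp.1.1]) le_rfl hp.1.2
    have h0 : 0 < Real.sin p.1 := Real.sin_pos_of_pos_of_lt_pi hp.1.1 (by linarith [hp.1.2])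
    have h2 : |Real.sin p.1 ^ 2 * Real.sin p.2 ^ 2| < 1 := by
      rw [abs_of_nonneg (by positivity)]
      have h3 := Real.sin_sq_le_one p.2
      nlinarith [sq_nonneg (Real.sin p.1)]
    refine HasSum.tsum_eq ?_
    refine ((hasSum_sqrt_one_sub h2).mul_right (Real.sin p.1 ^ 2)).congr_fun ?_
    intro n
    simp only [F]
    ring
  rw [integral_congr_ae hae, integral_prod _ (hint _ (by fun_prop)), hconv]
  refine intervalIntegral.integral_congr fun φ _ => ?_
  simp only [ellipticE]
  rw [integral_mul_const, hconv]

/-! ### The shadow as a section of the cylinder over the cube -/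

lemma sum_sq_coord (U : S2) : (U : E3) 0 ^ 2 + (U : E3) 1 ^ 2 + (U : E3) 2 ^ 2 = 1 := by
  have h := norm_eq_of_mem_sphere U
  rw [EuclideanSpace.norm_eq, Real.sqrt_eq_one, Fin.sum_univ_three] at h
  simpa [Real.norm_eq_abs, sq_abs] using h

lemma exists_coord_ne_zero (U : S2) : ∃ i, (U : E3) i ≠ 0 := by
  by_contra! h
  have := sum_sq_coord U
  simp [h] at this

lemma inner_eq_sum (x y : E3) : inner ℝ x y = x 0 * y 0 + x 1 * y 1 + x 2 * y 2 := by
  simp [PiLp.inner_apply, Fin.sum_univ_three, mul_comm]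

lemma mem_plane_iff (U : S2) (x : E3) : x ∈ plane U ↔ inner ℝ (U : E3) x = 0 :=
  Submodule.mem_orthogonal_singleton_iff_inner_right

lemma coe_orthogonalProjectionOnto_plane (U : S2) (v : E3) :
    (((plane U).orthogonalProjectionOnto v : plane U) : E3) =
      v - inner ℝ (U : E3) v • (U : E3) := by
  rw [Submodule.orthogonalProjectionOnto_orthogonal]
  simp only [Submodule.starProjection_unit_singleton ℝ (norm_eq_of_mem_sphere U)]

/-- The points whose line in the direction `u` meets the cube. -/
def cubeCylinder (u : E3) : Set E3 := {x | ∃ t : ℝ, x + t • u ∈ unitCube}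

lemma add_smul_mem_cubeCylinder {u x : E3} (s : ℝ) :
    x + s • u ∈ cubeCylinder u ↔ x ∈ cubeCylinder u := by
  constructor
  · rintro ⟨t, ht⟩
    exact ⟨s + t, by rwa [add_smul, ← add_assoc]⟩
  · rintro ⟨t, ht⟩
    exact ⟨t - s, by rw [add_assoc, ← add_smul]; simpa using ht⟩

lemma mem_shadow_iff (U : S2) (p : plane U) : p ∈ shadow U ↔ (p : E3) ∈ cubeCylinder U := by
  constructor
  · rintro ⟨v, hv, rfl⟩
    rw [coe_orthogonalProjectionOnto_plane, sub_eq_add_neg, ← neg_smul, add_smul_mem_cubeCylinder]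
    exact ⟨0, by simpa using hv⟩
  · rintro ⟨t, ht⟩
    refine ⟨_, ht, ?_⟩
    apply Subtype.ext
    have hp : inner ℝ (U : E3) (p : E3) = 0 := (mem_plane_iff U p).1 p.2
    rw [coe_orthogonalProjectionOnto_plane, inner_add_right, inner_smul_right, hp,
      real_inner_self_eq_norm_sq]
    simp

/-- The cylinder over the cube in the direction `u` is an intersection of strips. -/
lemma mem_cubeCylinder_iff {u : E3} (hu : ∃ i, u i ≠ 0) (x : E3) :
    x ∈ cubeCylinder u ↔ ∀ i j, |x i * u j - x j * u i| ≤ (|u i| + |u j|) / 2 := by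
  constructor
  · rintro ⟨t, ht⟩ i j
    have hi := ht i
    have hj := ht j
    simp only [PiLp.add_apply, PiLp.smul_apply, smul_eq_mul] at hi hj
    -- The cross product with `u` does not change along lines in the direction `u`.
    have e : x i * u j - x j * u i = (x i + t * u i) * u j - (x j + t * u j) * u i := by ring
    rw [e]
    refine (abs_sub _ _).trans ?_
    rw [abs_mul, abs_mul]
    nlinarith [abs_nonneg (u i), abs_nonneg (u j)]
  · intro h
    let S : Finset (Fin 3) := Finset.univ.filter fun i => u i ≠ 0
    have hS : S.Nonempty := by
      obtain ⟨i, hi⟩ := hu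
      exact ⟨i, by simp [S, hi]⟩
    -- Each coordinate with `u i ≠ 0` confines the parameter to an interval with centre `-x i / u i`
    -- and radius `1 / (2 |u i|)`. The pairwise inequalities say that these intervals meet in pairs,
    -- so the largest left endpoint lies in all of them, as in Helly's theorem on the line.
    let t := S.sup' hS fun i => -x i / u i - 1 / (2 * |u i|)
    refine ⟨t, fun i => ?_⟩
    simp only [PiLp.add_apply, PiLp.smul_apply, smul_eq_mul]
    by_cases hi : u i = 0
    · obtain ⟨j, hj⟩ := hu
      have := h i j
      simp only [hi, mul_zero, sub_zero, abs_mul, abs_zero, zero_add] at this ⊢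
      rw [add_zero]
      have hj' : 0 < |u j| := abs_pos.2 hj
      nlinarith
    · have hi' : 0 < |u i| := abs_pos.2 hi
      have h1 : -x i / u i - 1 / (2 * |u i|) ≤ t :=
        Finset.le_sup' (fun i => -x i / u i - 1 / (2 * |u i|)) (by simp [S, hi])
      have h2 : t ≤ -x i / u i + 1 / (2 * |u i|) := by
        refine Finset.sup'_le hS _ fun j hj => ?_
        have hj0 : u j ≠ 0 := by simpa [S] using hj
        have hj' : 0 < |u j| := abs_pos.2 hj0
        have e : x i / u i - x j / u j ≤ 1 / (2 * |u i|) + 1 / (2 * |u j|) := by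
          have e1 : x i / u i - x j / u j = (x i * u j - x j * u i) / (u i * u j) := by
            field_simp
          have e2 : 1 / (2 * |u i|) + 1 / (2 * |u j|) = (|u i| + |u j|) / 2 / |u i * u j| := by
            rw [abs_mul]; field_simp; ring
          rw [e1, e2]
          refine (le_abs_self _).trans ?_
          rw [abs_div]
          gcongr
          exact h i j
        rw [neg_div, neg_div]
        linarith
      have e : x i + t * u i = u i * (t - -x i / u i) := by field_simp; ring
      rw [e, abs_mul]
      have h3 : |t - -x i / u i| ≤ 1 / (2 * |u i|) := by
        rw [abs_le]; constructor <;> linarith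
      calc |u i| * |t - -x i / u i| ≤ |u i| * (1 / (2 * |u i|)) := by gcongr
        _ = 1 / 2 := by field_simp

lemma isClosed_cubeCylinder {u : E3} (hu : ∃ i, u i ≠ 0) : IsClosed (cubeCylinder u) := by
  have : cubeCylinder u = ⋂ i, ⋂ j, {x : E3 | |x i * u j - x j * u i| ≤ (|u i| + |u j|) / 2} := by
    ext x
    rw [mem_cubeCylinder_iff hu]
    simp
  rw [this]
  exact isClosed_iInter fun i => isClosed_iInter fun j => isClosed_le (by fun_prop) (by fun_prop)

/-! ### The area of the shadow -/

/-- The slab over the shadow has the shadow's area as its volume. -/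
lemma volume_shadow (U : S2) : volume (shadow U) =
    volume (cubeCylinder (U : E3) ∩ {x | inner ℝ (U : E3) x ∈ Icc (0 : ℝ) 1}) := by
  set K := Submodule.span ℝ {(U : E3)} with hK
  have hU : ‖(U : E3)‖ = 1 := norm_eq_of_mem_sphere U
  -- Fubini for the orthogonal sum of the line spanned by `U` and the plane: the slab corresponds to
  -- the product of a unit interval and the shadow.
  have hmp : MeasurePreserving (fun x : E3 => WithLp.ofLp (K.orthogonalDecomposition x)) :=
    (WithLp.volume_preserving_ofLp K Kᗮ).comp K.orthogonalDecomposition.measurePreserving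
  let e := LinearIsometryEquiv.toSpanUnitSingleton (𝕜 := ℝ) (U : E3) hU
  have hshadow : MeasurableSet (shadow U) := by
    have : shadow U = (Subtype.val : plane U → E3) ⁻¹' cubeCylinder U := by
      ext p; exact mem_shadow_iff U p
    rw [this]
    exact ((isClosed_cubeCylinder (exists_coord_ne_zero U)).preimage
      continuous_subtype_val).measurableSet
  have hT : MeasurableSet (e.symm ⁻¹' Icc (0 : ℝ) 1) :=
    (isClosed_Icc.preimage e.symm.continuous).measurableSet
  have hTvol : volume (e.symm ⁻¹' Icc (0 : ℝ) 1) = 1 := by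
    rw [e.symm.measurePreserving.measure_preimage measurableSet_Icc.nullMeasurableSet]
    simp
  have h1 : volume ((e.symm ⁻¹' Icc (0 : ℝ) 1) ×ˢ shadow U) = volume (shadow U) := by
    rw [Measure.volume_eq_prod, Measure.prod_prod, hTvol, one_mul]
  rw [← h1, ← hmp.measure_preimage (hT.prod hshadow).nullMeasurableSet]
  congr 1
  ext x
  have hin : e.symm (K.orthogonalProjectionOnto x) = inner ℝ (U : E3) x := by
    rw [LinearIsometryEquiv.symm_apply_eq]
    apply Subtype.ext
    rw [← Submodule.starProjection_apply, Submodule.starProjection_unit_singleton ℝ hU]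
    rfl
  have hfst : (WithLp.ofLp (K.orthogonalDecomposition x)).1 = K.orthogonalProjectionOnto x :=
    Submodule.fst_orthogonalDecomposition_apply _ _
  have hsnd : (WithLp.ofLp (K.orthogonalDecomposition x)).2 = Kᗮ.orthogonalProjectionOnto x :=
    Submodule.snd_orthogonalDecomposition_apply _ _
  simp only [mem_preimage, mem_prod, hfst, hsnd, hin, mem_inter_iff, mem_ofPred_eq]
  rw [mem_shadow_iff, coe_orthogonalProjectionOnto_plane, sub_eq_add_neg, ← neg_smul,
    add_smul_mem_cubeCylinder, and_comm]

lemma setOf_sweep_of_nonneg {a l h : ℝ} (ha : 0 ≤ a) (hlh : l ≤ h) :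
    {x : ℝ | ∃ τ ∈ Icc l h, |x + τ * a| ≤ 1 / 2} = Icc (-(1 / 2) - h * a) (1 / 2 - l * a) := by
  ext x
  simp only [mem_ofPred_eq, mem_Icc, abs_le]
  constructor
  · rintro ⟨τ, ⟨h1, h2⟩, h3, h4⟩
    have := mul_le_mul_of_nonneg_right h1 ha
    have := mul_le_mul_of_nonneg_right h2 ha
    constructor <;> linarith
  · rintro ⟨h1, h2⟩
    rcases ha.eq_or_lt with rfl | ha
    · exact ⟨l, ⟨le_rfl, hlh⟩, by linarith, by linarith⟩
    -- The smallest admissible `τ` with `x + τ * a ≥ -1/2`.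
    · refine ⟨max l ((-(1 / 2) - x) / a), ⟨le_max_left _ _, max_le hlh ?_⟩, ?_⟩
      · rw [div_le_iff₀ ha]; linarith
      · rcases le_total l ((-(1 / 2) - x) / a) with h3 | h3
        · rw [max_eq_right h3, div_mul_cancel₀ _ ha.ne']
          constructor <;> linarith
        · rw [max_eq_left h3]
          rw [div_le_iff₀ ha] at h3
          constructor <;> linarith

/-- Length of the set swept by a unit interval. -/
lemma volume_sweep {a l h : ℝ} (hlh : l ≤ h) :
    volume {x : ℝ | ∃ τ ∈ Icc l h, |x + τ * a| ≤ 1 / 2} = ENNReal.ofReal (1 + |a| * (h - l)) := by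
  rcases le_total 0 a with ha | ha
  · rw [setOf_sweep_of_nonneg ha hlh, Real.volume_Icc, abs_of_nonneg ha]
    ring_nf
  · have : {x : ℝ | ∃ τ ∈ Icc l h, |x + τ * a| ≤ 1 / 2} =
        {x : ℝ | ∃ τ ∈ Icc (-h) (-l), |x + τ * -a| ≤ 1 / 2} := by
      ext x
      constructor
      · rintro ⟨τ, ⟨h1, h2⟩, h3⟩
        exact ⟨-τ, ⟨by linarith, by linarith⟩, by simpa using h3⟩
      · rintro ⟨τ, ⟨h1, h2⟩, h3⟩
        exact ⟨-τ, ⟨by linarith, by linarith⟩, by simpa using h3⟩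
    rw [this, setOf_sweep_of_nonneg (by linarith) (by linarith), Real.volume_Icc, abs_of_nonpos ha]
    ring_nf

/-- The set swept by a unit square moving along a segment. -/
def sweptSquare (a b : ℝ) : Set (ℝ × ℝ) :=
  {q | ∃ τ ∈ Icc (-(1 / 2) : ℝ) (1 / 2), |q.1 + τ * a| ≤ 1 / 2 ∧ |q.2 + τ * b| ≤ 1 / 2}

lemma isCompact_sweptSquare (a b : ℝ) : IsCompact (sweptSquare a b) := by
  have : sweptSquare a b = (fun p : ℝ × ℝ × ℝ => (p.2.1 - p.1 * a, p.2.2 - p.1 * b)) ''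
      (Icc (-(1 / 2)) (1 / 2) ×ˢ Icc (-(1 / 2)) (1 / 2) ×ˢ Icc (-(1 / 2)) (1 / 2)) := by
    ext ⟨x, y⟩
    constructor
    · rintro ⟨τ, hτ, h1, h2⟩
      exact ⟨(τ, x + τ * a, y + τ * b), ⟨hτ, abs_le.1 h1, abs_le.1 h2⟩, by simp⟩
    · rintro ⟨⟨τ, x', y'⟩, ⟨hτ, h1, h2⟩, h⟩
      simp only [Prod.mk.injEq] at h
      obtain ⟨rfl, rfl⟩ := h
      exact ⟨τ, hτ, by simpa [abs_le] using h1, by simpa [abs_le] using h2⟩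
  rw [this]
  exact (isCompact_Icc.prod (isCompact_Icc.prod isCompact_Icc)).image (by fun_prop)

/-- At height `y` the admissible parameters form an interval `J y`, and a nonempty slice is the set
swept by a unit interval for `τ` in `J y`, of length `1 + |a| |J y|`. Integrating over `y` gives `1
+ |b|` from the heights that occur, plus `|a|` times the area of the region of pairs `(y, τ)`, which
is 1. -/
lemma volume_sweptSquare (a b : ℝ) :
    volume (sweptSquare a b) = ENNReal.ofReal (1 + |a| + |b|) := by
  let J : ℝ → Set ℝ := fun y => {τ | τ ∈ Icc (-(1 / 2) : ℝ) (1 / 2) ∧ |y + τ * b| ≤ 1 / 2}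
  let G : Set (ℝ × ℝ) := {p | p.2 ∈ J p.1}
  have hG : MeasurableSet G := by
    refine IsClosed.measurableSet ?_
    exact (isClosed_Icc.preimage continuous_snd).inter
      (isClosed_le (f := fun p : ℝ × ℝ => |p.1 + p.2 * b|) (by fun_prop) continuous_const)
  let Y : Set ℝ := {y | ∃ τ ∈ Icc (-(1 / 2) : ℝ) (1 / 2), |y + τ * b| ≤ 1 / 2}
  have hslice : ∀ y, volume ((fun x => (x, y)) ⁻¹' sweptSquare a b) =
      Y.indicator (fun _ => 1) y + ENNReal.ofReal |a| * volume (J y) := by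
    intro y
    by_cases hy : y ∈ Y
    · have hne : (J y).Nonempty := by
        obtain ⟨τ, h1, h2⟩ := hy
        exact ⟨τ, h1, h2⟩
      have hJ : J y = Icc (-(1 / 2) : ℝ) (1 / 2) ∩ {τ | |y + τ * b| ≤ 1 / 2} := rfl
      have hclosed : IsClosed {τ | |y + τ * b| ≤ 1 / 2} :=
        isClosed_le (by fun_prop) (by fun_prop)
      have hcpt : IsCompact (J y) := by
        rw [hJ]; exact isCompact_Icc.inter_right hclosed
      have hconv : Convex ℝ (J y) := by
        rw [hJ]
        refine (convex_Icc _ _).inter ?_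
        intro s hs t ht α β hα hβ hαβ
        simp only [mem_ofPred_eq, abs_le, smul_eq_mul] at hs ht ⊢
        have e : y + (α * s + β * t) * b = α * (y + s * b) + β * (y + t * b) := by
          linear_combination (-y) * hαβ
        rw [e]
        constructor <;> nlinarith
      have hIcc := eq_Icc_of_connected_compact ⟨hne, hconv.isPreconnected⟩ hcpt
      have hle : sInf (J y) ≤ sSup (J y) := by
        rw [hIcc] at hne; exact nonempty_Icc.1 hne
      have hset : ((fun x => (x, y)) ⁻¹' sweptSquare a b) =
          {x : ℝ | ∃ τ ∈ Icc (sInf (J y)) (sSup (J y)), |x + τ * a| ≤ 1 / 2} := by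
        rw [← hIcc]
        ext x
        constructor
        · rintro ⟨τ, h1, h2, h3⟩
          exact ⟨τ, ⟨h1, h3⟩, h2⟩
        · rintro ⟨τ, ⟨h1, h3⟩, h2⟩
          exact ⟨τ, h1, h2, h3⟩
      have hvol : volume (J y) = ENNReal.ofReal (sSup (J y) - sInf (J y)) := by
        conv_lhs => rw [hIcc]
        rw [Real.volume_Icc]
      have hle' := sub_nonneg.2 hle
      rw [hset, volume_sweep hle, indicator_of_mem hy, hvol, ← ENNReal.ofReal_mul (abs_nonneg a),
        ← ENNReal.ofReal_one, ← ENNReal.ofReal_add zero_le_one (by positivity)]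
    · have hJ : J y = ∅ := by
        by_contra h
        obtain ⟨τ, h1, h2⟩ := nonempty_iff_ne_empty.2 h
        exact hy ⟨τ, h1, h2⟩
      have hset : ((fun x => (x, y)) ⁻¹' sweptSquare a b) = ∅ := by
        ext x
        simp only [mem_empty_iff_false, iff_false]
        rintro ⟨τ, h1, h2, h3⟩
        exact hy ⟨τ, h1, h3⟩
      rw [hset, hJ, indicator_of_notMem hy]
      simp
  have hY : volume Y = ENNReal.ofReal (1 + |b|) := by
    have := volume_sweep (a := b) (l := -(1 / 2)) (h := 1 / 2) (by norm_num)
    rw [this]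
    norm_num
  have hYm : MeasurableSet Y := by
    rcases le_total 0 b with hb | hb
    · rw [show Y = _ from setOf_sweep_of_nonneg hb (by norm_num)]
      exact measurableSet_Icc
    · have : Y = (fun p : ℝ × ℝ => p.2) '' sweptSquare 0 b := by
        ext y
        constructor
        · rintro ⟨τ, h1, h2⟩
          exact ⟨(0, y), ⟨τ, h1, by norm_num, h2⟩, rfl⟩
        · rintro ⟨⟨x, y⟩, ⟨τ, h1, -, h2⟩, rfl⟩
          exact ⟨τ, h1, h2⟩
      rw [this]
      exact ((isCompact_sweptSquare 0 b).image continuous_snd).measurableSet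
  have hGvol : ∫⁻ y, volume (J y) = 1 := by
    have h1 : volume G = ∫⁻ y, volume (J y) := by
      rw [Measure.volume_eq_prod, Measure.prod_apply hG]
      rfl
    rw [← h1, Measure.volume_eq_prod, Measure.prod_apply_symm hG]
    have h2 : ∀ τ : ℝ, volume ((fun y => (y, τ)) ⁻¹' G) =
        (Icc (-(1 / 2) : ℝ) (1 / 2)).indicator (fun _ => 1) τ := by
      intro τ
      by_cases hτ : τ ∈ Icc (-(1 / 2) : ℝ) (1 / 2)
      · have : ((fun y => (y, τ)) ⁻¹' G) = Icc (-(1 / 2) - τ * b) (1 / 2 - τ * b) := by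
          ext y
          have : y ∈ (fun y => (y, τ)) ⁻¹' G ↔ |y + τ * b| ≤ 1 / 2 := and_iff_right hτ
          rw [this, abs_le, mem_Icc]
          constructor <;> rintro ⟨h3, h4⟩ <;> constructor <;> linarith
        rw [this, Real.volume_Icc, indicator_of_mem hτ]
        norm_num
      · have : ((fun y => (y, τ)) ⁻¹' G) = ∅ := by
          ext y
          simp only [G, J, mem_preimage, mem_ofPred_eq, hτ, false_and, mem_empty_iff_false]
        rw [this, indicator_of_notMem hτ, measure_empty]
    simp only [h2]
    rw [lintegral_indicator measurableSet_Icc]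
    norm_num
  rw [Measure.volume_eq_prod, Measure.prod_apply_symm (isCompact_sweptSquare a b).measurableSet]
  simp only [hslice]
  rw [lintegral_add_left (measurable_const.indicator hYm),
    lintegral_indicator hYm, lintegral_const_mul' _ _ (by simp), hGvol]
  simp only [lintegral_const, one_mul, Measure.restrict_apply MeasurableSet.univ, univ_inter, hY,
    mul_one]
  rw [← ENNReal.ofReal_add (by positivity) (abs_nonneg a)]
  ring_nf

/-- The slab over the projection of the cube along `u`. -/
def slab (u : E3) : Set E3 := cubeCylinder u ∩ {x | inner ℝ u x ∈ Icc (0 : ℝ) 1}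

/-- The shear `(x, q) ↦ (x, q + (x / u 0) • (u 1, u 2))` preserves volume and moves `(0, q)` along
`u`. After it, the cylinder condition involves only `q`, namely membership in a swept square with
slopes `u 1 / u 0` and `u 2 / u 0`, while the height condition leaves for `x` an interval of length
`|u 0|`. -/
lemma volume_slab_of_ne_zero {u : E3} (hu : ‖u‖ = 1) (h0 : u 0 ≠ 0) :
    volume (slab u) = ENNReal.ofReal (|u 0| + |u 1| + |u 2|) := by
  have hm : MeasurableSet (slab u) :=
    ((isClosed_cubeCylinder ⟨0, h0⟩).inter
      (isClosed_Icc.preimage (by fun_prop : Continuous fun x => inner ℝ u x))).measurableSet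
  have hm' := measurable_vec hm
  rw [← measurePreserving_vec.measure_preimage hm.nullMeasurableSet,
    ← lintegral_indicator_one hm', Measure.volume_eq_prod,
    lintegral_prod _ (measurable_one.indicator hm').aemeasurable]
  have htrans : ∀ x : ℝ, ∫⁻ q : ℝ × ℝ, (vec ⁻¹' slab u).indicator 1 (x, q) =
      ∫⁻ q : ℝ × ℝ, (vec ⁻¹' slab u).indicator 1 (x, q + (x / u 0) • (u 1, u 2)) := by
    intro x
    rw [lintegral_add_right_eq_self
      (fun q : ℝ × ℝ => (vec ⁻¹' slab u).indicator (1 : ℝ × ℝ × ℝ → ENNReal) (x, q))]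
  simp only [htrans]
  have hmeas : Measurable fun p : ℝ × ℝ × ℝ => (vec ⁻¹' slab u).indicator (1 : ℝ × ℝ × ℝ → ENNReal)
      (p.1, p.2 + (p.1 / u 0) • (u 1, u 2)) := by
    refine (measurable_one.indicator hm').comp ?_
    fun_prop
  rw [lintegral_lintegral_swap hmeas.aemeasurable]
  have hmem : ∀ x : ℝ, ∀ q : ℝ × ℝ, vec (x, q + (x / u 0) • (u 1, u 2)) ∈ slab u ↔
      q ∈ sweptSquare (u 1 / u 0) (u 2 / u 0) ∧
        u 1 * q.1 + u 2 * q.2 + x / u 0 ∈ Icc (0 : ℝ) 1 := by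
    intro x q
    have hv : vec (x, q + (x / u 0) • (u 1, u 2)) = vec (0, q) + (x / u 0) • u := by
      ext i
      fin_cases i <;> simp [h0]
    have hin : inner ℝ u (vec (0, q) + (x / u 0) • u) = u 1 * q.1 + u 2 * q.2 + x / u 0 := by
      rw [inner_add_right, inner_smul_right, real_inner_self_eq_norm_sq, hu, inner_eq_sum]
      simp
    rw [hv, slab, mem_inter_iff, add_smul_mem_cubeCylinder, mem_ofPred_eq, hin]
    refine and_congr_left fun _ => ?_
    constructor
    · rintro ⟨t, ht⟩
      have t0 := ht 0
      have t1 := ht 1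
      have t2 := ht 2
      simp at t0 t1 t2
      -- Reparametrize the line by its first coordinate, which starts at 0.
      refine ⟨t * u 0, abs_le.1 (by rw [abs_mul]; linarith), ?_, ?_⟩
      · rw [mul_assoc, mul_div_cancel₀ _ h0]; linarith
      · rw [mul_assoc, mul_div_cancel₀ _ h0]; linarith
    · rintro ⟨τ, h1, h2, h3⟩
      refine ⟨τ / u 0, fun i => ?_⟩
      fin_cases i
      · simpa [h0, abs_le] using h1
      · simpa [div_mul_eq_mul_div, mul_div_assoc] using h2
      · simpa [div_mul_eq_mul_div, mul_div_assoc] using h3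
  have hinner : ∀ q : ℝ × ℝ, ∫⁻ x : ℝ, (vec ⁻¹' slab u).indicator (1 : ℝ × ℝ × ℝ → ENNReal)
      (x, q + (x / u 0) • (u 1, u 2)) =
      (sweptSquare (u 1 / u 0) (u 2 / u 0)).indicator (fun _ => ENNReal.ofReal |u 0|) q := by
    intro q
    by_cases hq : q ∈ sweptSquare (u 1 / u 0) (u 2 / u 0)
    · rw [indicator_of_mem hq]
      set c := u 1 * q.1 + u 2 * q.2
      have e : ∀ x : ℝ, (vec ⁻¹' slab u).indicator (1 : ℝ × ℝ × ℝ → ENNReal)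
          (x, q + (x / u 0) • (u 1, u 2)) =
          ((fun x => x * (u 0)⁻¹) ⁻¹' Icc (-c) (1 - c)).indicator 1 x := by
        intro x
        have hiff : vec (x, q + (x / u 0) • (u 1, u 2)) ∈ slab u ↔
            x * (u 0)⁻¹ ∈ Icc (-c) (1 - c) := by
          rw [hmem, ← div_eq_mul_inv]
          simp only [hq, true_and, mem_Icc]
          constructor <;> rintro ⟨h3, h4⟩ <;> constructor <;> linarith
        by_cases hx : vec (x, q + (x / u 0) • (u 1, u 2)) ∈ slab u
        · rw [indicator_of_mem (by exact hx), indicator_of_mem (by exact hiff.1 hx)]; rfl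
        · rw [indicator_of_notMem (by exact hx),
            indicator_of_notMem (by exact fun h => hx (hiff.2 h))]
      simp only [e]
      rw [lintegral_indicator_one (measurableSet_Icc.preimage (by fun_prop)),
        Real.volume_preimage_mul_right (inv_ne_zero h0), inv_inv, Real.volume_Icc]
      simp
    · rw [indicator_of_notMem hq]
      have e : ∀ x : ℝ, (vec ⁻¹' slab u).indicator (1 : ℝ × ℝ × ℝ → ENNReal)
          (x, q + (x / u 0) • (u 1, u 2)) = 0 := fun x => by
        rw [indicator_of_notMem (by exact fun h => hq ((hmem x q).1 h).1)]
      simp only [e, lintegral_zero]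
  simp only [hinner]
  rw [lintegral_indicator (isCompact_sweptSquare _ _).measurableSet, setLIntegral_const,
    volume_sweptSquare, ← ENNReal.ofReal_mul (abs_nonneg _), abs_div, abs_div]
  congr 1
  have : |u 0| ≠ 0 := abs_ne_zero.2 h0
  field_simp

lemma volume_slab (U : S2) :
    volume (slab (U : E3)) = ENNReal.ofReal (∑ i, |(U : E3) i|) := by
  obtain ⟨i, hi⟩ := exists_coord_ne_zero U
  let e : Equiv.Perm (Fin 3) := Equiv.swap i 0
  let T : E3 ≃ₗᵢ[ℝ] E3 := LinearIsometryEquiv.piLpCongrLeft 2 ℝ ℝ e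
  have hTa : ∀ (x : E3) j, T x (e j) = x j := fun x j => by
    simp [T, LinearIsometryEquiv.piLpCongrLeft_apply]
  have hT0 : T (U : E3) 0 = (U : E3) i := by
    rw [← hTa (U : E3) i]; simp [e]
  have hcube : ∀ x : E3, T x ∈ unitCube ↔ x ∈ unitCube := fun x => by
    simp only [unitCube, mem_ofPred_eq]
    constructor
    · intro h j; rw [← hTa]; exact h _
    · intro h j
      obtain ⟨k, rfl⟩ := e.surjective j
      rw [hTa]; exact h k
  have hpre : T ⁻¹' slab (T U) = slab (U : E3) := by
    ext x
    simp only [slab, cubeCylinder, mem_preimage, mem_inter_iff, mem_ofPred_eq,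
      LinearIsometryEquiv.inner_map_map]
    simp only [← map_smul, ← map_add, hcube]
  rw [← hpre, T.measurePreserving.measure_preimage_emb T.toHomeomorph.measurableEmbedding,
    volume_slab_of_ne_zero (by simp) (by rwa [hT0])]
  have hsum : ∑ j, |T (U : E3) j| = ∑ j, |(U : E3) j| := by
    rw [← Equiv.sum_comp e]
    simp only [hTa]
  rw [← hsum, Fin.sum_univ_three]

/-- The area of the shadow. -/
lemma cw_eq (U : S2) : cw U = ∑ i, |(U : E3) i| := by
  rw [cw, measureReal_def, volume_shadow]
  have := volume_slab U
  rw [slab] at this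
  rw [this, ENNReal.toReal_ofReal]
  exact Finset.sum_nonneg fun i _ => abs_nonneg _

/-! ### The perimeter of the shadow -/

/-- The interior is given by strictness in every strip of positive width. Pairs with both
coordinates of `U` zero must be left out, as their inequality reads `0 ≤ 0` and is an equality
everywhere. -/
lemma frontier_shadow (U : S2) (p : plane U) : p ∈ frontier (shadow U) ↔
    (p : E3) ∈ cubeCylinder U ∧ ∃ i j, 0 < |(U : E3) i| + |(U : E3) j| ∧
      |(p : E3) i * (U : E3) j - (p : E3) j * (U : E3) i| = (|(U : E3) i| + |(U : E3) j|) / 2 := by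
  have hU := exists_coord_ne_zero U
  have hsh : shadow U = (Subtype.val : plane U → E3) ⁻¹' cubeCylinder U := by
    ext p; exact mem_shadow_iff U p
  have hclosed : IsClosed (shadow U) := by
    rw [hsh]; exact (isClosed_cubeCylinder hU).preimage continuous_subtype_val
  have hint : p ∈ interior (shadow U) ↔ ∀ i j, 0 < |(U : E3) i| + |(U : E3) j| →
      |(p : E3) i * (U : E3) j - (p : E3) j * (U : E3) i| <
        (|(U : E3) i| + |(U : E3) j|) / 2 := by
    constructor
    · intro hp i j hij
      -- An interior point stays in the shadow when scaled by some `s > 1`, which an equality at a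
      -- positive bound would forbid.
      have hcont : Continuous fun s : ℝ => s • p := by fun_prop
      have hev : ∀ᶠ s in nhds (1 : ℝ), s • p ∈ shadow U := by
        have h1 : interior (shadow U) ∈ nhds ((1 : ℝ) • p) := by
          rw [one_smul]; exact isOpen_interior.mem_nhds hp
        filter_upwards [hcont.continuousAt.preimage_mem_nhds h1] with s hs
        exact interior_subset hs
      obtain ⟨s, hs, hs1⟩ := ((hev.filter_mono nhdsWithin_le_nhds).and
        (self_mem_nhdsWithin : Ioi (1 : ℝ) ∈ nhdsWithin 1 (Ioi 1))).exists
      rw [mem_shadow_iff, mem_cubeCylinder_iff hU] at hs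
      have h2 := hs i j
      simp only [Submodule.coe_smul, PiLp.smul_apply, smul_eq_mul] at h2
      have e : s * (p : E3) i * (U : E3) j - s * (p : E3) j * (U : E3) i =
        s * ((p : E3) i * (U : E3) j - (p : E3) j * (U : E3) i) := by ring
      have hs1' : (1 : ℝ) < s := hs1
      rw [e, abs_mul, abs_of_pos (by linarith)] at h2
      by_contra! h3
      nlinarith
    · intro h
      rw [mem_interior]
      refine ⟨⋂ i, ⋂ j, {p : plane U | 0 < |(U : E3) i| + |(U : E3) j| →
        |(p : E3) i * (U : E3) j - (p : E3) j * (U : E3) i| <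
        (|(U : E3) i| + |(U : E3) j|) / 2}, ?_, ?_, by simpa using h⟩
      · intro q hq
        simp only [mem_iInter, mem_ofPred_eq] at hq
        rw [mem_shadow_iff, mem_cubeCylinder_iff hU]
        intro i j
        rcases (add_nonneg (abs_nonneg ((U : E3) i)) (abs_nonneg ((U : E3) j))).eq_or_lt with h0 | h0
        · have hi : (U : E3) i = 0 := abs_eq_zero.1 (by
            linarith [abs_nonneg ((U : E3) i), abs_nonneg ((U : E3) j)])
          have hj : (U : E3) j = 0 := abs_eq_zero.1 (by
            linarith [abs_nonneg ((U : E3) i), abs_nonneg ((U : E3) j)])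
          simp [hi, hj]
        · exact (hq i j h0).le
      · refine isOpen_iInter_of_finite fun i => isOpen_iInter_of_finite fun j => ?_
        by_cases h0 : 0 < |(U : E3) i| + |(U : E3) j|
        · simp only [h0, forall_const]
          exact isOpen_lt (by fun_prop) (by fun_prop)
        · simp [h0]
  rw [hclosed.frontier_eq, Set.mem_sdiff, hint, mem_shadow_iff]
  refine and_congr_right fun hp => ?_
  push Not
  rw [mem_cubeCylinder_iff hU] at hp
  refine exists_congr fun i => exists_congr fun j => and_congr_right fun _ => ?_
  exact ⟨fun h => le_antisymm (hp i j) h, fun h => h.ge⟩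

/-- The boundary of the shadow as a subset of three-space. -/
def shadowRim (U : S2) : Set E3 :=
  {x | inner ℝ (U : E3) x = 0 ∧ x ∈ cubeCylinder U ∧ ∃ i j, 0 < |(U : E3) i| + |(U : E3) j| ∧
      |x i * (U : E3) j - x j * (U : E3) i| = (|(U : E3) i| + |(U : E3) j|) / 2}

lemma pw_eq_shadowRim (U : S2) : pw U = (μH[1] : Measure E3).real (shadowRim U) := by
  have h : shadowRim U = (Subtype.val : plane U → E3) '' frontier (shadow U) := by
    ext x
    constructor
    · rintro ⟨h1, h2⟩
      exact ⟨⟨x, (mem_plane_iff U x).2 h1⟩, (frontier_shadow U _).2 h2, rfl⟩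
    · rintro ⟨p, hp, rfl⟩
      exact ⟨(mem_plane_iff U p).1 p.2, (frontier_shadow U p).1 hp⟩
  rw [pw, measureReal_def, measureReal_def, h,
    isometry_subtype_coe.hausdorffMeasure_image (Or.inl zero_le_one)]

/-- Length of a union of segments which meet pairwise in at most one point. -/
lemma hausdorffMeasure_iUnion_segment {ι : Type*} [Fintype ι] {S : ι → Set E3} (p q : ι → E3)
    (hS : ∀ a, S a = segment ℝ (p a) (q a))
    (hd : ∀ a b, a ≠ b → (S a ∩ S b).Subsingleton) :
    (μH[1] : Measure E3) (⋃ a, S a) = ENNReal.ofReal (∑ a, dist (p a) (q a)) := by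
  rw [measure_iUnion₀, tsum_fintype, ENNReal.ofReal_sum_of_nonneg fun _ _ => dist_nonneg]
  · refine Finset.sum_congr rfl fun a _ => ?_
    rw [hS, hausdorffMeasure_segment, edist_dist]
  · intro a b hab
    have := Measure.nullSingletonClass_hausdorff E3 (zero_lt_one' ℝ)
    exact (hd a b hab).measure_zero _
  · intro a
    rw [hS]
    refine (IsCompact.measurableSet ?_).nullMeasurableSet
    rw [segment_eq_image]
    exact isCompact_Icc.image (by fun_prop)

lemma sum_fin_three_of_ne {i j k : Fin 3} (hij : i ≠ j) (hjk : j ≠ k) (hik : i ≠ k) (g : Fin 3 → ℝ) :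
    ∑ l, g l = g i + g j + g k := by
  have h : (Finset.univ : Finset (Fin 3)) = {i, j, k} := by
    symm
    apply Finset.eq_univ_of_card
    rw [Finset.card_eq_three.2 ⟨i, j, k, hij, hik, hjk, rfl⟩]
    rfl
  rw [h, Finset.sum_insert (by simp [hij, hik]), Finset.sum_insert (by simp [hjk]),
    Finset.sum_singleton]
  ring

lemma inner_eq_of_ne {i j k : Fin 3} (hij : i ≠ j) (hjk : j ≠ k) (hik : i ≠ k) (x y : E3) :
    inner ℝ x y = x i * y i + x j * y j + x k * y k := by
  rw [PiLp.inner_apply, sum_fin_three_of_ne hij hjk hik]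
  simp [mul_comm]

lemma fin_three_cases {i j k : Fin 3} (hij : i ≠ j) (hjk : j ≠ k) (hik : i ≠ k) (l : Fin 3) :
    l = i ∨ l = j ∨ l = k := by
  decide +revert

lemma sq_add_sq_add_sq (U : S2) {i j k : Fin 3} (hij : i ≠ j) (hjk : j ≠ k) (hik : i ≠ k) :
    (U : E3) i ^ 2 + (U : E3) j ^ 2 + (U : E3) k ^ 2 = 1 := by
  have h := inner_eq_of_ne hij hjk hik (U : E3) U
  rw [real_inner_self_eq_norm_sq, norm_eq_of_mem_sphere] at h
  linarith

/-- A side of the shadow: the points of the shadow on one of its support lines. -/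
def shadowSide (U : S2) (j k : Fin 3) (ε : ℝ) : Set E3 :=
  {x | inner ℝ (U : E3) x = 0 ∧ x ∈ cubeCylinder U ∧
    x j * (U : E3) k - x k * (U : E3) j = ε * ((|(U : E3) j| + |(U : E3) k|) / 2)}

lemma exists_sign {a : ℝ} : ∃ s : ℝ, s * a = |a| ∧ s * s = 1 ∧ |s| = 1 := by
  rcases le_total 0 a with h | h
  · exact ⟨1, by simp [abs_of_nonneg h]⟩
  · exact ⟨-1, by simp [abs_of_nonpos h]⟩

/-- The vector with prescribed coordinates at three indices. -/
def vec3 (i j k : Fin 3) (a b c : ℝ) : E3 :=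
  EuclideanSpace.single i a + EuclideanSpace.single j b + EuclideanSpace.single k c

lemma vec3_fst {i j k : Fin 3} (hij : i ≠ j) (hik : i ≠ k) (a b c : ℝ) :
    vec3 i j k a b c i = a := by
  simp [vec3, hij, hik]

lemma vec3_snd {i j k : Fin 3} (hij : i ≠ j) (hjk : j ≠ k) (a b c : ℝ) :
    vec3 i j k a b c j = b := by
  simp [vec3, hij.symm, hjk]

lemma vec3_trd {i j k : Fin 3} (hjk : j ≠ k) (hik : i ≠ k) (a b c : ℝ) :
    vec3 i j k a b c k = c := by
  simp [vec3, hjk.symm, hik.symm]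

lemma ext_of_ne {i j k : Fin 3} (hij : i ≠ j) (hjk : j ≠ k) (hik : i ≠ k) {x y : E3}
    (hi : x i = y i) (hj : x j = y j) (hk : x k = y k) : x = y := by
  ext l
  rcases fin_three_cases hij hjk hik l with rfl | rfl | rfl <;> assumption

lemma starProjection_plane (U : S2) (v : E3) :
    (plane U).starProjection v = v - inner ℝ (U : E3) v • (U : E3) :=
  coe_orthogonalProjectionOnto_plane U v

/-- A linear functional vanishing on `U` attains its extreme value over the cube along an edge
parallel to axis `i`, and the side is the projection of that edge. The unit vector of axis `i` has
projected length `√(1 - uᵢ²)`. -/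
lemma shadowSide_eq_segment (U : S2) {i j k : Fin 3} (hij : i ≠ j) (hjk : j ≠ k) (hik : i ≠ k)
    (hj : (U : E3) j ≠ 0) (hk : (U : E3) k ≠ 0) {ε : ℝ} (hε : ε * ε = 1) :
    ∃ p q, shadowSide U j k ε = segment ℝ p q ∧ dist p q = Real.sqrt (1 - (U : E3) i ^ 2) := by
  obtain ⟨s, hs, hss, hsa⟩ := exists_sign (a := (U : E3) j)
  obtain ⟨r, hr, hrr, hra⟩ := exists_sign (a := (U : E3) k)
  have hεa : |ε| = 1 := by
    rw [← sq_eq_sq₀ (abs_nonneg _) zero_le_one, sq_abs]; linarith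
  set u : E3 := (U : E3) with hu
  have hj' : 0 < |u j| := abs_pos.2 hj
  have hk' : 0 < |u k| := abs_pos.2 hk
  -- The extremal edge: its two fixed coordinates are `±1/2`, with signs chosen so that `ε * (v j *
  -- u k - v k * u j)` is maximal.
  let v : ℝ → E3 := fun a => vec3 i j k a (ε * r / 2) (-(ε * s / 2))
  have vi : ∀ a, v a i = a := fun a => vec3_fst hij hik _ _ _
  have vj : ∀ a, v a j = ε * r / 2 := fun a => vec3_snd hij hjk _ _ _
  have vk : ∀ a, v a k = -(ε * s / 2) := fun a => vec3_trd hjk hik _ _ _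
  have hvx : ∀ a b : ℝ, a + b = 1 → a • v (-1 / 2) + b • v (1 / 2) = v (b - 1 / 2) := by
    intro a b hab
    refine ext_of_ne hij hjk hik ?_ ?_ ?_ <;>
      simp only [PiLp.add_apply, PiLp.smul_apply, smul_eq_mul, vi, vj, vk]
    · linear_combination (-1 / 2) * hab
    · linear_combination (ε * r / 2) * hab
    · linear_combination (-(ε * s / 2)) * hab
  refine ⟨(plane U).starProjection (v (-1 / 2)), (plane U).starProjection (v (1 / 2)), ?_, ?_⟩
  · have hmap : ∀ a b : ℝ, a + b = 1 → a • (plane U).starProjection (v (-1 / 2)) +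
        b • (plane U).starProjection (v (1 / 2)) = (plane U).starProjection (v (b - 1 / 2)) := by
      intro a b hab
      rw [← hvx a b hab, map_add, map_smul, map_smul]
    ext x
    constructor
    · rintro ⟨h1, ⟨t, ht⟩, h3⟩
      have ti := abs_le.1 (ht i)
      have tj := ht j
      have tk := ht k
      simp only [PiLp.add_apply, PiLp.smul_apply, smul_eq_mul] at ti tj tk
      set y := x i + t * u i with hy
      set z := x j + t * u j with hz
      set w := x k + t * u k with hw
      have e1 : ε * r * z ≤ 1 / 2 := by
        refine (le_abs_self _).trans ?_
        rw [abs_mul, abs_mul, hεa, hra]; linarith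
      have e2 : -(ε * s * w) ≤ 1 / 2 := by
        refine (neg_le_abs _).trans ?_
        rw [abs_mul, abs_mul, hεa, hsa]; linarith
      have e3 : z * u k - w * u j = ε * ((|u j| + |u k|) / 2) := by
        rw [← h3, hz, hw]; ring
      have hr' : u k = r * |u k| := by rw [← hr, ← mul_assoc, hrr, one_mul]
      have hs' : u j = s * |u j| := by rw [← hs, ← mul_assoc, hss, one_mul]
      -- Being on the support line means that two nonnegative defects sum to zero, so both
      -- coordinates are extremal.
      have e4 : (1 / 2 - ε * r * z) * |u k| + (1 / 2 + ε * s * w) * |u j| = 0 := by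
        have e5 : z * (r * |u k|) - w * (s * |u j|) = ε * ((|u j| + |u k|) / 2) := by
          rw [← hr', ← hs', e3]
        linear_combination (-ε) * e5 - (|u j| + |u k|) / 2 * hε
      have e5 : 0 ≤ (1 / 2 - ε * r * z) * |u k| := mul_nonneg (by linarith) hk'.le
      have e6 : 0 ≤ (1 / 2 + ε * s * w) * |u j| := mul_nonneg (by linarith) hj'.le
      have e7 : 1 / 2 - ε * r * z = 0 := by
        rcases mul_eq_zero.1 (show (1 / 2 - ε * r * z) * |u k| = 0 by linarith) with h | h
        · exact h
        · exact absurd h hk'.ne'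
      have e8 : 1 / 2 + ε * s * w = 0 := by
        rcases mul_eq_zero.1 (show (1 / 2 + ε * s * w) * |u j| = 0 by linarith) with h | h
        · exact h
        · exact absurd h hj'.ne'
      have hz' : z = ε * r / 2 := by
        linear_combination (-(ε * r)) * e7 - z * hε - z * ε * ε * hrr
      have hw' : w = -(ε * s / 2) := by
        linear_combination (ε * s) * e8 - w * hε - w * ε * ε * hss
      have hxv : x + t • u = v y := by
        refine ext_of_ne hij hjk hik ?_ ?_ ?_ <;>
          simp only [PiLp.add_apply, PiLp.smul_apply, smul_eq_mul, vi, vj, vk]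
        · exact hy.symm
        · exact hz'
        · exact hw'
      refine ⟨1 / 2 - y, 1 / 2 + y, by linarith [ti.2], by linarith [ti.1], by ring, ?_⟩
      rw [hmap _ _ (by ring), show 1 / 2 + y - 1 / 2 = y by ring, ← hxv, starProjection_plane,
        inner_add_right, h1, inner_smul_right, real_inner_self_eq_norm_sq, norm_eq_of_mem_sphere]
      simp [← hu]
    · rintro ⟨a, b, ha, hb, hab, rfl⟩
      rw [hmap a b hab, starProjection_plane]
      set w := v (b - 1 / 2)
      have hw : w ∈ unitCube := by
        intro l
        rcases fin_three_cases hij hjk hik l with rfl | rfl | rfl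
        · rw [vi, abs_le]; constructor <;> linarith
        · rw [vj, abs_div, abs_mul, hεa, hra]; norm_num
        · rw [vk, abs_neg, abs_div, abs_mul, hεa, hsa]; norm_num
      refine ⟨?_, ?_, ?_⟩
      · rw [inner_sub_right, inner_smul_right, real_inner_self_eq_norm_sq, norm_eq_of_mem_sphere]
        simp
      · rw [sub_eq_add_neg, ← neg_smul, add_smul_mem_cubeCylinder]
        exact ⟨0, by simpa using hw⟩
      · simp only [PiLp.sub_apply, PiLp.smul_apply, smul_eq_mul]
        rw [show w j = ε * r / 2 from vj _, show w k = -(ε * s / 2) from vk _]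
        simp only [← hu]
        linear_combination (ε / 2) * hr + (ε / 2) * hs
  · have hd : v (-1 / 2) - v (1 / 2) = -EuclideanSpace.single i (1 : ℝ) := by
      refine ext_of_ne hij hjk hik ?_ ?_ ?_ <;>
        simp only [PiLp.sub_apply, PiLp.neg_apply, vi, vj, vk]
      · norm_num
      · simp [hij.symm]
      · simp [hik.symm]
    rw [dist_eq_norm, ← map_sub, hd, map_neg, norm_neg, starProjection_plane]
    have hin : inner ℝ (U : E3) (EuclideanSpace.single i (1 : ℝ)) = u i := by
      simp [EuclideanSpace.inner_single_right, hu]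
    rw [← Real.sqrt_sq (norm_nonneg _), hin, norm_sub_sq_real, inner_smul_right,
      real_inner_comm, hin, norm_smul, norm_eq_of_mem_sphere]
    congr 1
    simp
    ring

/-- A vector orthogonal to `U` is determined by two components of its cross product with `U` when
the coordinate common to them is nonzero. Thus two support lines of different axes meet in at most
one point. -/
lemma eq_of_cross_eq (U : S2) {i j k : Fin 3} (hij : i ≠ j) (hjk : j ≠ k) (hik : i ≠ k)
    (hk : (U : E3) k ≠ 0) {x y : E3} (hx : inner ℝ (U : E3) x = 0) (hy : inner ℝ (U : E3) y = 0)
    (h₁ : x j * (U : E3) k - x k * (U : E3) j = y j * (U : E3) k - y k * (U : E3) j)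
    (h₂ : x i * (U : E3) k - x k * (U : E3) i = y i * (U : E3) k - y k * (U : E3) i) : x = y := by
  have hn := sq_add_sq_add_sq U hij hjk hik
  rw [inner_eq_of_ne hij hjk hik] at hx hy
  have ek : x k = y k := by
    linear_combination (y k - x k) * hn + (U : E3) k * hx - (U : E3) k * hy - (U : E3) i * h₂
      - (U : E3) j * h₁
  have ej : x j = y j := by
    apply mul_right_cancel₀ hk
    linear_combination h₁ + (U : E3) j * ek
  have ei : x i = y i := by
    apply mul_right_cancel₀ hk
    linear_combination h₂ + (U : E3) i * ek
  exact ext_of_ne hij hjk hik ei ej ek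

/-- The two signs. -/
def boolSign (b : Bool) : ℝ := if b then 1 else -1

lemma boolSign_mul_self (b : Bool) : boolSign b * boolSign b = 1 := by
  cases b <;> norm_num [boolSign]

lemma abs_eq_iff_boolSign {a c : ℝ} (hc : 0 ≤ c) : |a| = c ↔ ∃ b, a = boolSign b * c := by
  rw [abs_eq hc]
  simp [boolSign, or_comm]

lemma boolSign_mul_injective {c : ℝ} (hc : c ≠ 0) {b b' : Bool}
    (h : boolSign b * c = boolSign b' * c) : b = b' := by
  have := mul_right_cancel₀ hc h
  cases b <;> cases b' <;> simp [boolSign] at this ⊢ <;> linarith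

lemma abs_add_abs_pos {a b : ℝ} (h : a ≠ 0) : 0 < |a| + |b| :=
  add_pos_of_pos_of_nonneg (abs_pos.2 h) (abs_nonneg b)

/-- The generic shadow is a hexagon: one pair of opposite sides for each axis. Opposite sides are
disjoint and sides of different axes share at most a point, so the lengths add. -/
lemma hausdorffMeasure_shadowRim_of_ne_zero (U : S2) (h0 : ∀ i, (U : E3) i ≠ 0) :
    (μH[1] : Measure E3) (shadowRim U) =
      ENNReal.ofReal (2 * ∑ i, Real.sqrt (1 - (U : E3) i ^ 2)) := by
  have n1 : ∀ i : Fin 3, i ≠ i + 1 := by decide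
  have n2 : ∀ i : Fin 3, i + 1 ≠ i + 2 := by decide
  have n3 : ∀ i : Fin 3, i ≠ i + 2 := by decide
  let S : Fin 3 × Bool → Set E3 := fun a => shadowSide U (a.1 + 1) (a.1 + 2) (boolSign a.2)
  have hex : ∀ a : Fin 3 × Bool, ∃ p q, S a = segment ℝ p q ∧
      dist p q = Real.sqrt (1 - (U : E3) a.1 ^ 2) := fun a =>
    shadowSide_eq_segment U (n1 a.1) (n2 a.1) (n3 a.1) (h0 _) (h0 _) (boolSign_mul_self a.2)
  choose p q hseg hdist using hex
  have hU : shadowRim U = ⋃ a, S a := by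
    ext x
    simp only [mem_iUnion, Prod.exists]
    constructor
    · rintro ⟨h1, h2, i, j, h3, h4⟩
      have key : ∃ l : Fin 3, |x (l + 1) * (U : E3) (l + 2) - x (l + 2) * (U : E3) (l + 1)| =
          (|(U : E3) (l + 1)| + |(U : E3) (l + 2)|) / 2 := by
        have hij : i ≠ j := by
          rintro rfl
          simp at h4
          exact h0 i (abs_eq_zero.1 h4.symm)
        have hcases : ∃ l : Fin 3, (i = l + 1 ∧ j = l + 2) ∨ (i = l + 2 ∧ j = l + 1) := by
          clear h3 h4
          decide +revert
        obtain ⟨l, ⟨rfl, rfl⟩ | ⟨rfl, rfl⟩⟩ := hcases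
        · exact ⟨l, h4⟩
        · exact ⟨l, by rw [abs_sub_comm, h4, add_comm |(U : E3) (l + 2)|]⟩
      obtain ⟨l, hl⟩ := key
      obtain ⟨b, hb⟩ := (abs_eq_iff_boolSign (by positivity)).1 hl
      exact ⟨l, b, h1, h2, hb⟩
    · rintro ⟨l, b, h1, h2, h3⟩
      exact ⟨h1, h2, l + 1, l + 2, abs_add_abs_pos (h0 _),
        (abs_eq_iff_boolSign (by positivity)).2 ⟨b, h3⟩⟩
  rw [hU, hausdorffMeasure_iUnion_segment p q hseg]
  · congr 1
    simp only [hdist, Fintype.sum_prod_type, Fintype.sum_bool, ← two_mul, Finset.mul_sum]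
  · rintro ⟨i, b⟩ ⟨i', b'⟩ hne x ⟨⟨hx1, -, hx2⟩, -, -, hx3⟩ y ⟨⟨hy1, -, hy2⟩, -, -, hy3⟩
    simp only at hx2 hx3 hy2 hy3
    by_cases hii : i = i'
    · subst hii
      refine absurd ?_ hne
      rw [hx2] at hx3
      rw [boolSign_mul_injective (half_pos (abs_add_abs_pos (h0 _))).ne' hx3]
    · have hcases : i' = i + 1 ∨ i' = i + 2 := by
        clear hx2 hx3 hy2 hy3 hne
        decide +revert
      have e3 : ∀ i : Fin 3, i + 1 + 1 = i + 2 := by decide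
      have e4 : ∀ i : Fin 3, i + 1 + 2 = i := by decide
      have e5 : ∀ i : Fin 3, i + 2 + 1 = i := by decide
      have e6 : ∀ i : Fin 3, i + 2 + 2 = i + 1 := by decide
      rcases hcases with rfl | rfl
      · rw [e3, e4] at hx3 hy3
        refine eq_of_cross_eq U (n1 i) (n2 i) (n3 i) (h0 _) hx1 hy1 (by rw [hx2, hy2]) ?_
        linarith
      · rw [e5, e6] at hx3 hy3
        refine eq_of_cross_eq U (n3 i) (n2 i).symm (n1 i) (h0 _) hx1 hy1 ?_ (by rw [hx3, hy3])
        linarith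

/-- Projecting parallel to a face gives a rectangle with sides `1` and `|uᵢ| + |uⱼ|`, since the
strips that pair `k` with a nonzero coordinate all reduce to `|x k| ≤ 1/2`. As `uᵢ² + uⱼ² = 1`, the
roots in the formula are `|uⱼ|`, `|uᵢ|` and `1`. A second vanishing coordinate is allowed. -/
lemma hausdorffMeasure_shadowRim_of_eq_zero (U : S2) {i j k : Fin 3} (hij : i ≠ j) (hjk : j ≠ k)
    (hik : i ≠ k) (h0 : (U : E3) k = 0) :
    (μH[1] : Measure E3) (shadowRim U) =
      ENNReal.ofReal (2 * ∑ i, Real.sqrt (1 - (U : E3) i ^ 2)) := by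
  have hn := sq_add_sq_add_sq U hij hjk hik
  have hin : ∀ x : E3, inner ℝ (U : E3) x = (U : E3) i * x i + (U : E3) j * x j := fun x => by
    rw [inner_eq_of_ne hij hjk hik, h0]; ring
  have hrim : ∀ x : E3, x ∈ shadowRim U ↔ inner ℝ (U : E3) x = 0 ∧
      |x i * (U : E3) j - x j * (U : E3) i| ≤ (|(U : E3) i| + |(U : E3) j|) / 2 ∧
      |x k| ≤ 1 / 2 ∧
      (|x i * (U : E3) j - x j * (U : E3) i| = (|(U : E3) i| + |(U : E3) j|) / 2 ∨
        |x k| = 1 / 2) := by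
    obtain ⟨m, hm, hmk⟩ : ∃ m, (U : E3) m ≠ 0 ∧ (m = i ∨ m = j) := by
      obtain ⟨m, hm⟩ := exists_coord_ne_zero U
      rcases fin_three_cases hij hjk hik m with h | h | h
      · exact ⟨m, hm, Or.inl h⟩
      · exact ⟨m, hm, Or.inr h⟩
      · exact absurd (h ▸ h0) hm
    intro x
    rw [shadowRim, mem_ofPred_eq, mem_cubeCylinder_iff ⟨m, hm⟩]
    refine and_congr_right fun _ => ?_
    constructor
    · rintro ⟨h1, a, b, h2, h3⟩
      have hx : |x k| ≤ 1 / 2 := by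
        have := h1 k m
        rw [h0, mul_zero, sub_zero, abs_zero, zero_add, abs_mul] at this
        have := abs_pos.2 hm
        nlinarith
      refine ⟨h1 i j, hx, ?_⟩
      have hside : ∀ l, 0 < |(U : E3) l| → |x k * (U : E3) l| = |(U : E3) l| / 2 →
          |x k| = 1 / 2 := by
        intro l hl hl'
        rw [abs_mul] at hl'
        exact mul_right_cancel₀ hl.ne' (by linarith)
      rcases fin_three_cases hij hjk hik a with rfl | rfl | rfl <;>
        rcases fin_three_cases hij hjk hik b with rfl | rfl | rfl <;>
        simp only [h0, sub_self, mul_zero, zero_sub, sub_zero, abs_zero, add_zero, zero_add,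
          abs_neg, lt_self_iff_false] at h2 h3
      · linarith
      · exact Or.inl h3
      · exact Or.inr (hside _ h2 h3)
      · left; rw [abs_sub_comm, h3, add_comm]
      · linarith
      · exact Or.inr (hside _ h2 h3)
      · exact Or.inr (hside _ h2 h3)
      · exact Or.inr (hside _ h2 h3)
    · rintro ⟨h1, h2, h3⟩
      have hside : ∀ l, |x k * (U : E3) l| ≤ |(U : E3) l| / 2 := by
        intro l
        rw [abs_mul]
        nlinarith [abs_nonneg ((U : E3) l)]
      refine ⟨fun a b => ?_, ?_⟩
      · rcases fin_three_cases hij hjk hik a with rfl | rfl | rfl <;>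
          rcases fin_three_cases hij hjk hik b with rfl | rfl | rfl <;>
          simp only [h0, sub_self, mul_zero, zero_sub, sub_zero, abs_zero, add_zero, zero_add,
            abs_neg, zero_div, le_refl]
        · positivity
        · exact h1
        · exact hside _
        · rw [abs_sub_comm, add_comm]; exact h1
        · positivity
        · exact hside _
        · exact hside _
        · exact hside _
      · have hpos := abs_pos.2 hm
        rcases h3 with h3 | h3
        · refine ⟨i, j, ?_, h3⟩
          rcases hmk with rfl | rfl
          · exact abs_add_abs_pos hm
          · rw [add_comm]; exact abs_add_abs_pos hm
        · refine ⟨k, m, by rw [h0]; simpa using hm, ?_⟩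
          rw [h0, mul_zero, sub_zero, abs_zero, zero_add, abs_mul, h3]
          ring
  set u : E3 := (U : E3) with hu
  set c := (|u i| + |u j|) / 2 with hc
  have hn' : u i ^ 2 + u j ^ 2 = 1 := by rw [h0] at hn; linarith
  have hcpos : 0 < c := by
    have h1 : u i ≠ 0 ∨ u j ≠ 0 := by
      by_contra! h
      rw [h.1, h.2] at hn'
      norm_num at hn'
    rcases h1 with h | h
    · exact half_pos (abs_add_abs_pos h)
    · rw [hc, add_comm]; exact half_pos (abs_add_abs_pos h)
  -- Isometric coordinates on the plane: `X` along the unit vector `(u j, -u i)` of the plane of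
  -- axes `i` and `j`, and `Y` along axis `k`.
  let R : ℝ → ℝ → E3 := fun X Y => vec3 i j k (X * u j) (-(X * u i)) Y
  have Ri : ∀ X Y, R X Y i = X * u j := fun X Y => vec3_fst hij hik _ _ _
  have Rj : ∀ X Y, R X Y j = -(X * u i) := fun X Y => vec3_snd hij hjk _ _ _
  have Rk : ∀ X Y, R X Y k = Y := fun X Y => vec3_trd hjk hik _ _ _
  have hR : ∀ x : E3, inner ℝ u x = 0 → x = R (x i * u j - x j * u i) (x k) := by
    intro x hx
    rw [hin] at hx
    refine ext_of_ne hij hjk hik ?_ ?_ (Rk _ _).symm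
    · rw [Ri]; linear_combination u i * hx - x i * hn'
    · rw [Rj]; linear_combination u j * hx - x j * hn'
  have hRin : ∀ X Y, inner ℝ u (R X Y) = 0 := fun X Y => by rw [hin, Ri, Rj]; ring
  have hRX : ∀ X Y, R X Y i * u j - R X Y j * u i = X := fun X Y => by
    rw [Ri, Rj]; linear_combination X * hn'
  have hcomb : ∀ a b X Y X' Y' : ℝ, a • R X Y + b • R X' Y' = R (a * X + b * X') (a * Y + b * Y') := by
    intro a b X Y X' Y'
    refine ext_of_ne hij hjk hik ?_ ?_ ?_ <;>
      simp only [PiLp.add_apply, PiLp.smul_apply, smul_eq_mul, Ri, Rj, Rk] <;> ring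
  have hdist : ∀ X Y X' Y' : ℝ, dist (R X Y) (R X' Y') = Real.sqrt ((X - X') ^ 2 + (Y - Y') ^ 2) := by
    intro X Y X' Y'
    rw [EuclideanSpace.dist_eq, sum_fin_three_of_ne hij hjk hik]
    simp only [Ri, Rj, Rk, Real.dist_eq, sq_abs]
    congr 1
    linear_combination (X - X') ^ 2 * hn'
  -- The first flag selects the sides `X = ±c` of length 1 (true) or `Y = ±1/2` of length `2c`
  -- (false); the second is the sign.
  let S : Bool × Bool → Set E3 := fun a => if a.1 then
      {x | inner ℝ u x = 0 ∧ x i * u j - x j * u i = boolSign a.2 * c ∧ |x k| ≤ 1 / 2} else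
      {x | inner ℝ u x = 0 ∧ |x i * u j - x j * u i| ≤ c ∧ x k = boolSign a.2 * (1 / 2)}
  let p : Bool × Bool → E3 := fun a => if a.1 then R (boolSign a.2 * c) (-(1 / 2))
    else R (-c) (boolSign a.2 * (1 / 2))
  let q : Bool × Bool → E3 := fun a => if a.1 then R (boolSign a.2 * c) (1 / 2)
    else R c (boolSign a.2 * (1 / 2))
  have hseg : ∀ a, S a = segment ℝ (p a) (q a) := by
    rintro ⟨_ | _, b⟩
    · ext x
      simp only [S, p, q, Bool.false_eq_true, if_false, mem_ofPred_eq]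
      constructor
      · rintro ⟨h1, h2, h3⟩
        set X := x i * u j - x j * u i with hX
        rw [abs_le] at h2
        refine ⟨(c - X) / (2 * c), (c + X) / (2 * c), div_nonneg (by linarith) (by linarith),
          div_nonneg (by linarith) (by linarith), by field_simp; ring, ?_⟩
        rw [hcomb, hR x h1, ← hX, h3]
        congr 1 <;> field_simp <;> ring
      · rintro ⟨α, β, hα, hβ, hαβ, rfl⟩
        rw [hcomb]
        refine ⟨hRin _ _, ?_, ?_⟩
        · rw [hRX, abs_le]; constructor <;> nlinarith
        · rw [Rk]; linear_combination (boolSign b * (1 / 2)) * hαβ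
    · ext x
      simp only [S, p, q, if_true, mem_ofPred_eq]
      constructor
      · rintro ⟨h1, h2, h3⟩
        rw [abs_le] at h3
        refine ⟨1 / 2 - x k, 1 / 2 + x k, by linarith, by linarith, by ring, ?_⟩
        rw [hcomb, hR x h1, h2, Rk]
        congr 1 <;> ring
      · rintro ⟨α, β, hα, hβ, hαβ, rfl⟩
        rw [hcomb]
        refine ⟨hRin _ _, ?_, ?_⟩
        · rw [hRX]; linear_combination (boolSign b * c) * hαβ
        · rw [Rk, abs_le]; constructor <;> linarith
  have hlen : ∀ a, dist (p a) (q a) = if a.1 then 1 else 2 * c := by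
    rintro ⟨_ | _, b⟩
    · simp only [p, q, Bool.false_eq_true, if_false, hdist]
      rw [show (-c - c) ^ 2 + (boolSign b * (1 / 2) - boolSign b * (1 / 2)) ^ 2 = (2 * c) ^ 2 by ring,
        Real.sqrt_sq (by positivity)]
    · simp only [p, q, if_true, hdist]
      norm_num
  have hU : shadowRim U = ⋃ a, S a := by
    ext x
    rw [hrim]
    simp only [mem_iUnion, Prod.exists, Bool.exists_bool (p := fun a => ∃ b, x ∈ S (a, b))]
    simp only [S, Bool.false_eq_true, if_false, if_true, mem_ofPred_eq]
    constructor
    · rintro ⟨h1, h2, h3, h4 | h4⟩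
      · obtain ⟨b, hb⟩ := (abs_eq_iff_boolSign hcpos.le).1 h4
        exact Or.inr ⟨b, h1, hb, h3⟩
      · obtain ⟨b, hb⟩ := (abs_eq_iff_boolSign (by norm_num)).1 h4
        exact Or.inl ⟨b, h1, h2, hb⟩
    · rintro (⟨b, h1, h2, h3⟩ | ⟨b, h1, h2, h3⟩)
      · have := (abs_eq_iff_boolSign (by norm_num)).2 ⟨b, h3⟩
        exact ⟨h1, h2, this.le, Or.inr this⟩
      · have := (abs_eq_iff_boolSign hcpos.le).2 ⟨b, h2⟩
        exact ⟨h1, this.le, h3, Or.inl this⟩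
  rw [hU, hausdorffMeasure_iUnion_segment p q hseg]
  · congr 1
    simp only [hlen, Fintype.sum_prod_type, Fintype.sum_bool, if_true, Bool.false_eq_true, if_false]
    rw [sum_fin_three_of_ne hij hjk hik, h0, show 1 - u i ^ 2 = u j ^ 2 by linarith,
      show 1 - u j ^ 2 = u i ^ 2 by linarith, Real.sqrt_sq_eq_abs, Real.sqrt_sq_eq_abs, hc]
    norm_num
    ring
  · rintro ⟨a, b⟩ ⟨a', b'⟩ hne x ⟨hx, hx'⟩ y ⟨hy, hy'⟩
    rcases a <;> rcases a' <;>
      simp only [S, Bool.false_eq_true, if_false, if_true, mem_ofPred_eq] at hx hx' hy hy'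
    · refine absurd ?_ hne
      rw [boolSign_mul_injective (by norm_num) (hx.2.2.symm.trans hx'.2.2)]
    · rw [hR x hx.1, hR y hy.1, hx.2.2, hy.2.2, hx'.2.1, hy'.2.1]
    · rw [hR x hx.1, hR y hy.1, hx'.2.2, hy'.2.2, hx.2.1, hy.2.1]
    · refine absurd ?_ hne
      rw [boolSign_mul_injective hcpos.ne' (hx.2.1.symm.trans hx'.2.1)]

/-- The perimeter of the shadow. -/
lemma pw_eq (U : S2) : pw U = 2 * ∑ i, Real.sqrt (1 - (U : E3) i ^ 2) := by
  have h : (μH[1] : Measure E3) (shadowRim U) =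
      ENNReal.ofReal (2 * ∑ i, Real.sqrt (1 - (U : E3) i ^ 2)) := by
    by_cases h0 : ∀ i, (U : E3) i ≠ 0
    · exact hausdorffMeasure_shadowRim_of_ne_zero U h0
    · push Not at h0
      obtain ⟨k, hk⟩ := h0
      have hne : ∀ k : Fin 3, k + 1 ≠ k + 2 ∧ k + 2 ≠ k ∧ k + 1 ≠ k := by decide
      exact hausdorffMeasure_shadowRim_of_eq_zero U (hne k).1 (hne k).2.1 (hne k).2.2 hk
  rw [pw_eq_shadowRim, measureReal_def, h, ENNReal.toReal_ofReal]
  have : 0 ≤ ∑ i, Real.sqrt (1 - (U : E3) i ^ 2) := Finset.sum_nonneg fun i _ => Real.sqrt_nonneg _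
  linarith

/-! ### Moments of area and perimeter -/

lemma continuous_cw : Continuous cw := by
  have : cw = fun U : S2 => ∑ i, |(U : E3) i| := funext cw_eq
  rw [this]
  fun_prop

lemma continuous_pw : Continuous pw := by
  have : pw = fun U : S2 => 2 * ∑ i, Real.sqrt (1 - (U : E3) i ^ 2) := funext pw_eq
  rw [this]
  fun_prop

lemma memLp_of_continuous {f : S2 → ℝ} (hf : Continuous f) : MemLp f 2 uniformS2 :=
  hf.memLp_of_hasCompactSupport (HasCompactSupport.of_compactSpace f)

lemma mean_cw : ∫ U, cw U ∂uniformS2 = 3 / 2 := by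
  simp only [cw_eq]
  rw [integral_finsetSum _ fun i _ => integrable_of_continuous (by fun_prop)]
  simp only [mean_abs_coord, Finset.sum_const, Finset.card_univ, Fintype.card_fin]
  norm_num

lemma mean_pw : ∫ U, pw U ∂uniformS2 = 3 * Real.pi / 2 := by
  simp only [pw_eq]
  rw [integral_const_mul,
    integral_finsetSum _ fun i _ => integrable_of_continuous (by fun_prop)]
  simp only [mean_sqrt_coord, Finset.sum_const, Finset.card_univ, Fintype.card_fin]
  ring

lemma mean_cw_sq : ∫ U, cw U ^ 2 ∂uniformS2 = 1 + 4 / Real.pi := by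
  have e : ∀ U : S2, cw U ^ 2 = 1 + 2 * (|(U : E3) 0| * |(U : E3) 1| +
      (|(U : E3) 0| * |(U : E3) 2| + |(U : E3) 1| * |(U : E3) 2|)) := fun U => by
    rw [cw_eq, Fin.sum_univ_three]
    have := sum_sq_coord U
    rw [← sq_abs, ← sq_abs ((U : E3) 1), ← sq_abs ((U : E3) 2)] at this
    linear_combination this
  simp only [e]
  rw [integral_add (integrable_const _) (integrable_of_continuous (by fun_prop)),
    integral_const_mul, integral_add (integrable_of_continuous (by fun_prop))
      (integrable_of_continuous (by fun_prop)), integral_add (integrable_of_continuous (by fun_prop))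
      (integrable_of_continuous (by fun_prop)), mean_abs_mul_abs (by decide),
    mean_abs_mul_abs (by decide), mean_abs_mul_abs (by decide)]
  simp
  field_simp
  norm_num

lemma one_sub_coord_sq_nonneg (U : S2) (i : Fin 3) : 0 ≤ 1 - (U : E3) i ^ 2 := by
  have := sum_sq_coord U
  have h0 := sq_nonneg ((U : E3) 0)
  have h1 := sq_nonneg ((U : E3) 1)
  have h2 := sq_nonneg ((U : E3) 2)
  rw [sub_nonneg]
  match i with
  | 0 => linarith
  | 1 => linarith
  | 2 => linarith

lemma mean_pw_sq : ∫ U, pw U ^ 2 ∂uniformS2 =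
    8 + 6 * Real.pi * hyp3F2 (-1 / 2) (1 / 2) (3 / 2) 1 2 1 := by
  have e : ∀ U : S2, pw U ^ 2 = 8 + 8 * (Real.sqrt (1 - (U : E3) 0 ^ 2) *
      Real.sqrt (1 - (U : E3) 1 ^ 2) + (Real.sqrt (1 - (U : E3) 0 ^ 2) *
      Real.sqrt (1 - (U : E3) 2 ^ 2) + Real.sqrt (1 - (U : E3) 1 ^ 2) *
      Real.sqrt (1 - (U : E3) 2 ^ 2))) := fun U => by
    rw [pw_eq, Fin.sum_univ_three]
    have h := sum_sq_coord U
    have h0 := Real.mul_self_sqrt (one_sub_coord_sq_nonneg U 0)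
    have h1 := Real.mul_self_sqrt (one_sub_coord_sq_nonneg U 1)
    have h2 := Real.mul_self_sqrt (one_sub_coord_sq_nonneg U 2)
    linear_combination 4 * h0 + 4 * h1 + 4 * h2 - 4 * h
  simp only [e]
  rw [integral_add (integrable_const _) (integrable_of_continuous (by fun_prop)),
    integral_const_mul, integral_add (integrable_of_continuous (by fun_prop))
      (integrable_of_continuous (by fun_prop)), integral_add (integrable_of_continuous (by fun_prop))
      (integrable_of_continuous (by fun_prop)), mean_sqrt_mul_sqrt (by decide),
    mean_sqrt_mul_sqrt (by decide), mean_sqrt_mul_sqrt (by decide), ellipticE_integral, hyp3F2_eq]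
  simp
  field_simp
  ring

lemma mean_cw_mul_pw : ∫ U, cw U * pw U ∂uniformS2 = 2 + 16 / Real.pi := by
  have e : ∀ U : S2, cw U * pw U = 2 * ∑ i, ∑ j, |(U : E3) i| * Real.sqrt (1 - (U : E3) j ^ 2) :=
    fun U => by
    rw [cw_eq, pw_eq, ← Finset.sum_mul_sum]
    ring
  have hterm : ∀ i j : Fin 3, ∫ U : S2, |(U : E3) i| * Real.sqrt (1 - (U : E3) j ^ 2) ∂uniformS2 =
      if i = j then 1 / 3 else 4 / (3 * Real.pi) := by
    intro i j
    split_ifs with h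
    · subst h; exact mean_abs_mul_sqrt_self i
    · exact mean_abs_mul_sqrt (Ne.symm h)
  simp only [e]
  rw [integral_const_mul, integral_finsetSum _ fun i _ => integrable_of_continuous (by fun_prop)]
  have hrow : ∀ i : Fin 3,
      ∫ U : S2, ∑ j, |(U : E3) i| * Real.sqrt (1 - (U : E3) j ^ 2) ∂uniformS2 =
        ∑ j, if i = j then 1 / 3 else 4 / (3 * Real.pi) := fun i => by
    rw [integral_finsetSum _ fun j _ => integrable_of_continuous (by fun_prop)]
    simp only [hterm]
  simp only [hrow]
  simp [Fin.sum_univ_three]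
  field_simp
  ring

end CubeShadow

end

/-! ### Decimal expansions and the correlation -/

theorem mainTheorem1 :
    -- area and perimeter of the shadow in terms of the unit normal
    (∀ U : CubeShadow.S2, CubeShadow.cw U = ∑ i, |(U : CubeShadow.E3) i|) ∧
    (∀ U : CubeShadow.S2,
      CubeShadow.pw U = 2 * ∑ i, Real.sqrt (1 - (U : CubeShadow.E3) i ^ 2)) ∧
    -- second moments exist, and the hypergeometric series converges
    MemLp CubeShadow.cw 2 CubeShadow.uniformS2 ∧
    MemLp CubeShadow.pw 2 CubeShadow.uniformS2 ∧
    Summable (CubeShadow.hyp3F2Term (-1 / 2) (1 / 2) (3 / 2) 1 2 1) ∧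
    -- the moments
    (∫ U, CubeShadow.cw U ∂CubeShadow.uniformS2 = 3 / 2) ∧
    (∫ U, CubeShadow.cw U ^ 2 ∂CubeShadow.uniformS2 = 1 + 4 / Real.pi) ∧
    (∫ U, CubeShadow.pw U ∂CubeShadow.uniformS2 = 3 * Real.pi / 2) ∧
    (∫ U, CubeShadow.pw U ^ 2 ∂CubeShadow.uniformS2 =
      8 + 6 * Real.pi * CubeShadow.hyp3F2 (-1 / 2) (1 / 2) (3 / 2) 1 2 1) ∧
    (∫ U, CubeShadow.cw U * CubeShadow.pw U ∂CubeShadow.uniformS2 = 2 + 16 / Real.pi) ∧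
    -- the elliptic integral behind the second moment of the perimeter
    (∫ φ in (0 : ℝ)..(Real.pi / 2), CubeShadow.ellipticE (Real.sin φ) * Real.sin φ ^ 2 =
      Real.pi ^ 2 / 8 * CubeShadow.hyp3F2 (-1 / 2) (1 / 2) (3 / 2) 1 2 1) ∧
    -- decimal expansions, truncated after 15 decimals
    (∫ U, CubeShadow.cw U ^ 2 ∂CubeShadow.uniformS2) ∈
      Set.Ico (2.273239544735162 : ℝ) 2.273239544735163 ∧
    (∫ U, CubeShadow.pw U ∂CubeShadow.uniformS2) ∈
      Set.Ico (4.712388980384689 : ℝ) 4.712388980384690 ∧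
    (∫ U, CubeShadow.pw U ^ 2 ∂CubeShadow.uniformS2) ∈
      Set.Ico (22.237117433439470 : ℝ) 22.237117433439471 ∧
    (∫ U, CubeShadow.cw U * CubeShadow.pw U ∂CubeShadow.uniformS2) ∈
      Set.Ico (7.092958178940650 : ℝ) 7.092958178940651 ∧
    -- the correlation is 0.915...
    CubeShadow.correlation CubeShadow.cw CubeShadow.pw CubeShadow.uniformS2 ∈
      Set.Ico (0.915 : ℝ) 0.916 := by
  have hπ := Real.pi_pos
  have hπ1 := Real.pi_gt_d20
  have hπ2 := Real.pi_lt_d20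
  have hcw := CubeShadow.memLp_of_continuous CubeShadow.continuous_cw
  have hpw := CubeShadow.memLp_of_continuous CubeShadow.continuous_pw
  have d1 : (∫ U, CubeShadow.cw U ^ 2 ∂CubeShadow.uniformS2) ∈
      Set.Ico (2.273239544735162 : ℝ) 2.273239544735163 := by
    rw [CubeShadow.mean_cw_sq]
    constructor
    · rw [← sub_le_iff_le_add', le_div_iff₀ hπ]
      norm_num at hπ2 ⊢
      linarith
    · rw [← lt_sub_iff_add_lt', div_lt_iff₀ hπ]
      norm_num at hπ1 ⊢
      linarith
  have d2 : (∫ U, CubeShadow.pw U ∂CubeShadow.uniformS2) ∈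
      Set.Ico (4.712388980384689 : ℝ) 4.712388980384690 := by
    rw [CubeShadow.mean_pw]
    norm_num at hπ1 hπ2
    constructor <;> norm_num <;> linarith
  have d3 : (∫ U, CubeShadow.pw U ^ 2 ∂CubeShadow.uniformS2) ∈
      Set.Ico (22.237117433439470 : ℝ) 22.237117433439471 := by
    rw [CubeShadow.mean_pw_sq, CubeShadow.hyp3F2_eq]
    have hF1 := CubeShadow.decimal_le_tsum_hypCoeff
    have hF2 := CubeShadow.tsum_hypCoeff_le_decimal
    have h1 := mul_le_mul hπ1.le hF1 (by norm_num) hπ.le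
    have h2 := mul_le_mul hπ2.le hF2 ((by norm_num : (0 : ℝ) ≤ _).trans hF1) (by norm_num)
    norm_num at h1 h2
    constructor <;> norm_num <;> linarith
  have d4 : (∫ U, CubeShadow.cw U * CubeShadow.pw U ∂CubeShadow.uniformS2) ∈
      Set.Ico (7.092958178940650 : ℝ) 7.092958178940651 := by
    rw [CubeShadow.mean_cw_mul_pw]
    constructor
    · rw [← sub_le_iff_le_add', le_div_iff₀ hπ]
      norm_num at hπ2 ⊢
      linarith
    · rw [← lt_sub_iff_add_lt', div_lt_iff₀ hπ]
      norm_num at hπ1 ⊢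
      linarith
  refine ⟨CubeShadow.cw_eq, CubeShadow.pw_eq, hcw, hpw, CubeShadow.summable_hyp3F2Term,
    CubeShadow.mean_cw, CubeShadow.mean_cw_sq, CubeShadow.mean_pw, CubeShadow.mean_pw_sq,
    CubeShadow.mean_cw_mul_pw, ?_, d1, d2, d3, d4, ?_⟩
  · rw [CubeShadow.ellipticE_integral, CubeShadow.hyp3F2_eq]
  · have hcov : cov[CubeShadow.cw, CubeShadow.pw; CubeShadow.uniformS2] =
        (∫ U, CubeShadow.cw U * CubeShadow.pw U ∂CubeShadow.uniformS2) -
          3 / 2 * ∫ U, CubeShadow.pw U ∂CubeShadow.uniformS2 := by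
      rw [covariance_eq_sub hcw hpw, CubeShadow.mean_cw]
      rfl
    have hvc : Var[CubeShadow.cw; CubeShadow.uniformS2] =
        (∫ U, CubeShadow.cw U ^ 2 ∂CubeShadow.uniformS2) - (3 / 2) ^ 2 := by
      rw [variance_eq_sub hcw, CubeShadow.mean_cw]
      rfl
    have hvp : Var[CubeShadow.pw; CubeShadow.uniformS2] =
        (∫ U, CubeShadow.pw U ^ 2 ∂CubeShadow.uniformS2) -
          (∫ U, CubeShadow.pw U ∂CubeShadow.uniformS2) ^ 2 := by
      rw [variance_eq_sub hpw]
      rfl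
    rw [CubeShadow.correlation, hcov, hvc, hvp]
    set a := ∫ U, CubeShadow.cw U ^ 2 ∂CubeShadow.uniformS2
    set m := ∫ U, CubeShadow.pw U ∂CubeShadow.uniformS2
    set b := ∫ U, CubeShadow.pw U ^ 2 ∂CubeShadow.uniformS2
    set c := ∫ U, CubeShadow.cw U * CubeShadow.pw U ∂CubeShadow.uniformS2
    obtain ⟨a1, a2⟩ := d1
    obtain ⟨m1, m2⟩ := d2
    obtain ⟨b1, b2⟩ := d3
    obtain ⟨c1, c2⟩ := d4
    have hm1 : (4.712388980384689 : ℝ) ^ 2 ≤ m ^ 2 := by gcongr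
    have hm2 : m ^ 2 ≤ (4.712388980384690 : ℝ) ^ 2 := by
      have : 0 ≤ m := le_trans (by norm_num) m1
      gcongr
    -- Variances and covariance are small differences of much larger moments; the digits of the
    -- moments leave ample accuracy.
    have A1 : (0.0232395447 : ℝ) ≤ a - (3 / 2) ^ 2 := by norm_num at a1 ⊢; linarith
    have A2 : a - (3 / 2) ^ 2 ≤ (0.0232395448 : ℝ) := by norm_num at a2 ⊢; linarith
    have B1 : (0.030507530 : ℝ) ≤ b - m ^ 2 := by norm_num at b1 hm2 ⊢; linarith
    have B2 : b - m ^ 2 ≤ (0.030507532 : ℝ) := by norm_num at b2 hm1 ⊢; linarith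
    have C1 : (0.02437470 : ℝ) ≤ c - 3 / 2 * m := by norm_num at c1 m2 ⊢; linarith
    have C2 : c - 3 / 2 * m ≤ (0.02437471 : ℝ) := by norm_num at c2 m1 ⊢; linarith
    have hp1 := mul_le_mul A1 B1 (by norm_num) ((by norm_num : (0 : ℝ) ≤ _).trans A1)
    have hp2 := mul_le_mul A2 B2 ((by norm_num : (0 : ℝ) ≤ _).trans B1) (by norm_num)
    have hA0 : 0 ≤ a - (3 / 2) ^ 2 := (by norm_num : (0 : ℝ) ≤ _).trans A1
    rw [← Real.sqrt_mul hA0]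
    -- The geometric mean of the variances is about 0.026627. These bounds suffice: `0.02437470 /
    -- 0.02663 > 0.915` and `0.02437471 / 0.02662 < 0.916`.
    have hs1 : (0.02662 : ℝ) ≤ Real.sqrt ((a - (3 / 2) ^ 2) * (b - m ^ 2)) :=
      Real.le_sqrt_of_sq_le (le_trans (by norm_num) hp1)
    have hs2 : Real.sqrt ((a - (3 / 2) ^ 2) * (b - m ^ 2)) ≤ (0.02663 : ℝ) :=
      Real.sqrt_le_iff.2 ⟨by norm_num, hp2.trans (by norm_num)⟩
    have hs0 : 0 < Real.sqrt ((a - (3 / 2) ^ 2) * (b - m ^ 2)) := lt_of_lt_of_le (by norm_num) hs1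
    constructor
    · rw [le_div_iff₀ hs0]
      norm_num at C1 hs2 ⊢
      linarith
    · rw [div_lt_iff₀ hs0]
      norm_num at C2 hs1 ⊢
      linarith
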